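/- Let $d\ge 2$, $n\ge 1$, let $\mathbb S=\{x\in\mathbb R^d:\|x\|=1\}$ with geodesic distance $d_{\mathbb S}(x,y)=\arccos\langle x,y\rangle$, and let $\mathrm{Unif}(\mathbb S)$ be the uniform probability distribution on $\mathbb S$. For a configuration $X=(x_1,\dots,x_n)\in\mathbb S^n$ define the Lloyd objective $$\mathcal L(X)=\mathbb E_{y\sim \mathrm{Unif}(\mathbb S)}\Big[\min_{1\le j\le n}\tfrac12 d_{\mathbb S}(y,x_j)^2\Big],$$ the Voronoi cells $V_X(i)=\{s\in\mathbb S: d_{\mathbb S}(s,x_i)\le d_{\mathbb S}(s,x_j)\text{ for all }j\ne i\}$, and $$Q_i(X,y)=\mathrm{Log}_{x_i}(y)\,1_{V_X(i)}(y),\qquad Q(X,y)=(Q_1(X,y),\dots,Q_n(X,y)).$$ Here $\mathrm{Exp}_x(v)=\cos(\|v\|)\,x+\sin(\|v\|)\,v/\|v\|$ for $v\perp x$ (with $\mathrm{Exp}_x(0)=x$), and $\mathrm{Log}_x(y)=\frac{\theta}{\sin\theta}(y-\cos\theta\, x)$ with $\theta=d_{\mathbb S}(x,y)$, where $\mathrm{Log}_x(\pm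 x):=0$. The Riemannian gradient on $\mathbb S$ or $\mathbb S^n$ is the orthogonal projection, onto the tangent space, of the Euclidean gradient of an extension; $\mathbb S^n$ carries the product metric, $\|(v_1,\dots,v_n)\|^2=\sum_i\|v_i\|^2$. 1. (Gradient.) If $x_1,\dots,x_n$ are pairwise distinct, then $\mathcal L$ is differentiable at $X$, $Q(X,\cdot)$ is integrable, and $$\operatorname{grad}_X\mathcal L(X)=-\mathbb E_y[Q(X,y)],\qquad \|\operatorname{grad}_X\mathcal L(X)\|\le\pi\sqrt n.$$ Likewise blockwise: for each $i$, the map $x\mapsto\mathcal L(x_1,\dots,x_{i-1},x,x_{i+1},\dots,x_n)$ is differentiable at $x_i$, $Q_i(X,\cdot)$ is integrable, and $\operatorname{grad}_{x_i}\mathcal L(X)=-\mathbb E_y[Q_i(X,y)]$. 2. (Bounds.) For all $X\in\mathbb S^n$, $y\in\mathbb S$ and $i$: $\|Q_i(X,y)\|=d_{\mathbb S}(x_i,y)1_{V_X(i)}(y)$ if $y\neq -x_i$; always $\|Q_i(X,y)\|\le\pi$; and $\|Q(X,y)\|\le\pi\sqrt n$. 3. (Convergence of Riemannian SGD.) Let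 $\gamma_t\ge 0$ satisfy $\sum_t\gamma_t^2<\infty$ and $\sum_t\gamma_t=\infty$. Let $y_0,y_1,\dots$ be i.i.d. uniform on $\mathbb S$, and let $X^{(0)}$ be a (possibly random) initial configuration, independent of $(y_t)_t$, whose centers are almost surely pairwise distinct. Let $X^{(t+1)}$ be obtained from $X^{(t)}$ by the Riemannian stochastic gradient step with stochastic gradient $-Q(X^{(t)},y_t)$: $$x_i^{(t+1)}=\mathrm{Exp}_{x_i^{(t)}}\big(-\gamma_t\cdot(-Q_i(X^{(t)},y_t))\big),\qquad 1\le i\le n.$$ Then almost surely: the centers of $X^{(t)}$ are pairwise distinct for every $t$, so that $\mathcal L$ is differentiable at $X^{(t)}$; $\mathcal L(X^{(t)})$ converges to a finite limit; and $\operatorname{grad}_X\mathcal L(X^{(t)})\to 0$. -/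

import Mathlib

open MeasureTheory ProbabilityTheory Filter Topology
open scoped InnerProductSpace

namespace Lloyd

/-- The unit sphere of `ℝᵈ`, a sphere of dimension `d - 1`. -/
abbrev Sph (d : ℕ) : Type := Metric.sphere (0 : EuclideanSpace ℝ (Fin d)) 1

/-- The Euclidean space `(ℝᵈ)ⁿ` with norm `‖v‖² = ∑ i, ‖v i‖²`. It contains the product
`(Sph d)ⁿ` and the tangent spaces of that product. -/
abbrev Amb (d n : ℕ) : Type := PiLp 2 (fun _ : Fin n => EuclideanSpace ℝ (Fin d))

/-- A configuration of `n` centers on the sphere, seen as a point of `(ℝᵈ)ⁿ`. -/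
noncomputable def toAmb {d n : ℕ} (X : Fin n → Sph d) : Amb d n :=
  WithLp.toLp 2 (fun i => (X i : EuclideanSpace ℝ (Fin d)))

/-- The uniform probability distribution on the sphere: normalized surface measure. -/
noncomputable def unif (d : ℕ) : Measure (Sph d) :=
  ((volume : Measure (EuclideanSpace ℝ (Fin d))).toSphere Set.univ)⁻¹ •
    (volume : Measure (EuclideanSpace ℝ (Fin d))).toSphere

/-- The geodesic (angular) distance on the sphere. -/
noncomputable def geoDist {d : ℕ} (x y : Sph d) : ℝ :=
  Real.arccos ⟪(x : EuclideanSpace ℝ (Fin d)), y⟫_ℝ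

/-- The formula of the Riemannian exponential map of the sphere,
`Exp_x(v) = cos ‖v‖ x + sin ‖v‖ (v / ‖v‖)`, for `v` orthogonal to `x`. -/
noncomputable def expVec {d : ℕ} (x : Sph d) (v : EuclideanSpace ℝ (Fin d)) :
    EuclideanSpace ℝ (Fin d) :=
  Real.cos ‖v‖ • (x : EuclideanSpace ℝ (Fin d)) + (Real.sin ‖v‖ / ‖v‖) • v

/-- The Riemannian logarithm of the sphere,
`Log_x(y) = (θ / sin θ) (y - cos θ x)` with `θ` the geodesic distance of `x` and `y`. It is not
defined in the usual sense at the antipode `y = -x`, where the formula gives `0`. -/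
noncomputable def logVec {d : ℕ} (x y : Sph d) : EuclideanSpace ℝ (Fin d) :=
  (geoDist x y / Real.sin (geoDist x y)) •
    ((y : EuclideanSpace ℝ (Fin d)) -
      Real.cos (geoDist x y) • (x : EuclideanSpace ℝ (Fin d)))

/-- The (closed) spherical Voronoi cell of the `i`-th center. -/
def voronoi {d n : ℕ} (X : Fin n → Sph d) (i : Fin n) : Set (Sph d) :=
  {s | ∀ j, j ≠ i → geoDist s (X i) ≤ geoDist s (X j)}

/-- The Lloyd objective `E_y [min_j (1/2) d(y, x_j)²]`, with `y` uniform on the sphere. -/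
noncomputable def lloyd {d n : ℕ} (X : Fin n → Sph d) : ℝ :=
  ∫ y, (⨅ j : Fin n, (1 / 2 : ℝ) * geoDist y (X j) ^ 2) ∂(unif d)

open Classical in
/-- `Q_i(X, y) = Log_{x_i}(y) 1_{V_X(i)}(y)`. -/
noncomputable def Qi {d n : ℕ} (X : Fin n → Sph d) (y : Sph d) (i : Fin n) :
    EuclideanSpace ℝ (Fin d) :=
  if y ∈ voronoi X i then logVec (X i) y else 0

/-- `Q(X, y) = (Q_1(X, y), …, Q_n(X, y))`. -/
noncomputable def Q {d n : ℕ} (X : Fin n → Sph d) (y : Sph d) : Amb d n :=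
  WithLp.toLp 2 (fun i => Qi X y i)

/-- `F : Sph d → ℝ` is differentiable at `x`, with Riemannian gradient `G`: the orthogonal
projection to the tangent space at `x` of the Euclidean gradient at `x` of an extension of `F`. -/
def HasSphGradAt {d : ℕ} (F : Sph d → ℝ) (G : EuclideanSpace ℝ (Fin d)) (x : Sph d) : Prop :=
  ∃ (F' : EuclideanSpace ℝ (Fin d) → ℝ) (g : EuclideanSpace ℝ (Fin d)),
    (∀ z : Sph d, F' z = F z) ∧ HasGradientAt F' g (x : EuclideanSpace ℝ (Fin d)) ∧
    G = g - ⟪(x : EuclideanSpace ℝ (Fin d)), g⟫_ℝ • (x : EuclideanSpace ℝ (Fin d))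

/-- `F : (Sph d)ⁿ → ℝ` is differentiable at `X`, with Riemannian gradient `G` for the product
metric: the orthogonal projection to the tangent space at `X` of the Euclidean gradient at `X` of
an extension of `F`. -/
def HasRiemGradAt {d n : ℕ} (F : (Fin n → Sph d) → ℝ) (G : Amb d n) (X : Fin n → Sph d) : Prop :=
  ∃ (F' : Amb d n → ℝ) (g : Amb d n),
    (∀ Z : Fin n → Sph d, F' (toAmb Z) = F Z) ∧ HasGradientAt F' g (toAmb X) ∧
    ∀ i, G i = g i - ⟪(X i : EuclideanSpace ℝ (Fin d)), g i⟫_ℝ •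
      (X i : EuclideanSpace ℝ (Fin d))

theorem inner_self_sph {d : ℕ} (x : Sph d) :
    ⟪(x : EuclideanSpace ℝ (Fin d)), x⟫_ℝ = 1 := by
  rw [real_inner_self_eq_norm_sq, norm_eq_of_mem_sphere]; norm_num

theorem inner_logVec {d : ℕ} (x y : Sph d) :
    ⟪(x : EuclideanSpace ℝ (Fin d)), logVec x y⟫_ℝ = 0 := by
  have h := abs_real_inner_le_norm (x : EuclideanSpace ℝ (Fin d)) (y : EuclideanSpace ℝ (Fin d))
  rw [norm_eq_of_mem_sphere, norm_eq_of_mem_sphere, one_mul, abs_le] at h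
  rw [logVec, inner_smul_right, inner_sub_right, inner_smul_right, inner_self_sph, geoDist,
    Real.cos_arccos h.1 h.2]
  simp

theorem inner_Qi {d n : ℕ} (X : Fin n → Sph d) (y : Sph d) (i : Fin n) :
    ⟪(X i : EuclideanSpace ℝ (Fin d)), Qi X y i⟫_ℝ = 0 := by
  unfold Qi
  split_ifs
  · exact inner_logVec _ _
  · exact inner_zero_right _

theorem norm_expVec {d : ℕ} (x : Sph d) (v : EuclideanSpace ℝ (Fin d))
    (h : ⟪(x : EuclideanSpace ℝ (Fin d)), v⟫_ℝ = 0) : ‖expVec x v‖ = 1 := by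
  have hx := norm_eq_of_mem_sphere x
  have key : ‖expVec x v‖ ^ 2 = 1 := by
    rw [expVec, norm_add_sq_real, inner_smul_left, inner_smul_right, h, norm_smul, norm_smul, hx]
    by_cases hv : ‖v‖ = 0
    · simp [hv]
    · have : ‖Real.sin ‖v‖ / ‖v‖‖ * ‖v‖ = |Real.sin ‖v‖| := by
        rw [norm_div, norm_norm, Real.norm_eq_abs]; field_simp
      rw [this]
      simp
  exact (pow_eq_one_iff_of_nonneg (norm_nonneg _) two_ne_zero).1 key

/-- One step of Riemannian stochastic gradient descent with step size `c` and sample `y`: as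
`-Q(X, y)` is the stochastic gradient, the new centers are `Exp_{x_i}(-c (-Q_i(X, y)))`. -/
noncomputable def step {d n : ℕ} (c : ℝ) (y : Sph d) (X : Fin n → Sph d) : Fin n → Sph d :=
  fun i => ⟨expVec (X i) (-c • (-Qi X y i)), by
    rw [mem_sphere_zero_iff_norm]
    apply norm_expVec
    rw [inner_smul_right, inner_neg_right, inner_Qi]
    simp⟩

/-- The iterates of Riemannian stochastic gradient descent for the Lloyd objective, with step
sizes `γ`, samples `y` and initial configuration `X₀`. -/
noncomputable def sgd {d n : ℕ} (γ : ℕ → ℝ) (y : ℕ → Sph d) (X₀ : Fin n → Sph d) :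
    ℕ → Fin n → Sph d
  | 0 => X₀
  | t + 1 => step (γ t) (y t) (sgd γ y X₀ t)

end Lloyd

namespace Lloyd

variable {d n : ℕ}

/-! If the centers are distinct, almost every `y` is generic: it is no center or antipode of one,
and it has a single nearest center. Near the configuration the integrand is then half the squared
distance to that center, whose gradient is minus a logarithm. A Lipschitz bound at the base point
allows differentiation under the integral (`hasGradientAt_integral_extCost`). The extension off the
sphere uses angles, and its gradient `-meanQ X` is already tangent.

For the stochastic iteration, continuity of the gradient is available only away from collisions, and
no Lipschitz bound for it is used. Three facts replace smoothness.

Semiconcavity: spherical triangles are thinner than Euclidean ones, so the objective lies below a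
quadratic model with constant 1 along the exponential map (`lloyd_le_of_eq_expVec`). The martingale
noise has convergent weighted sums (`ae_tendsto_sum_of_indep`), so the objective converges and `∑ γ
t * ‖meanQ‖ ^ 2` is finite.

Repulsion: near a collision the gradient cannot be small. Merging a cluster of radius `ρ` costs at
most `O(ρ ‖meanQ‖ + ρ ^ 2)` by semiconcavity, whereas splitting the merged point gains a fixed
multiple of `ρ` up to `O(ρ ^ 2)` (`le_norm_meanQ_of_cluster`). Compactness turns this into uniform
control of the gradient near points where it is small (`exists_norm_meanQ_lt`).

Excursions: while the gradient exceeds `δ`, the path length is bounded by the tail of `∑ γ t *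
‖meanQ‖ ^ 2` divided by `δ`, so late iterates stay close to one with small gradient
(`tendsto_zero_of_perturbed_gradient`). Collisions almost surely never occur (`ae_injective_sgd`).
-/

/-! ### Geodesic distance, logarithm and exponential on the sphere. -/

theorem inner_mem_Icc (x y : Sph d) :
    ⟪(x : EuclideanSpace ℝ (Fin d)), y⟫_ℝ ∈ Set.Icc (-1 : ℝ) 1 := by
  have h := abs_real_inner_le_norm (x : EuclideanSpace ℝ (Fin d)) (y : EuclideanSpace ℝ (Fin d))
  rw [norm_eq_of_mem_sphere, norm_eq_of_mem_sphere, one_mul, abs_le] at h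
  exact h

theorem geoDist_eq_angle (x y : Sph d) :
    geoDist x y =
      InnerProductGeometry.angle (x : EuclideanSpace ℝ (Fin d)) (y : EuclideanSpace ℝ (Fin d)) := by
  simp [geoDist, InnerProductGeometry.angle]

theorem geoDist_comm (x y : Sph d) : geoDist x y = geoDist y x := by
  rw [geoDist, geoDist, real_inner_comm]

theorem geoDist_nonneg (x y : Sph d) : 0 ≤ geoDist x y := Real.arccos_nonneg _

theorem geoDist_le_pi (x y : Sph d) : geoDist x y ≤ Real.pi := Real.arccos_le_pi _

theorem cos_geoDist (x y : Sph d) :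
    Real.cos (geoDist x y) = ⟪(x : EuclideanSpace ℝ (Fin d)), y⟫_ℝ :=
  Real.cos_arccos (inner_mem_Icc x y).1 (inner_mem_Icc x y).2

theorem geoDist_eq_zero_iff {x y : Sph d} : geoDist x y = 0 ↔ x = y := by
  rw [geoDist, Real.arccos_eq_zero]
  constructor
  · intro h
    have h1 := le_antisymm (inner_mem_Icc x y).2 h
    exact Subtype.ext ((inner_eq_one_iff_of_norm_eq_one (by simp) (by simp)).1 h1)
  · rintro rfl
    rw [inner_self_sph]

@[simp] theorem geoDist_self (x : Sph d) : geoDist x x = 0 := geoDist_eq_zero_iff.2 rfl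

theorem geoDist_eq_pi_iff {x y : Sph d} : geoDist x y = Real.pi ↔ y = -x := by
  have h : geoDist x (-y) = Real.pi - geoDist x y := by
    rw [geoDist, geoDist, coe_neg_sphere, inner_neg_right, Real.arccos_neg]
  rw [← sub_eq_zero, ← neg_eq_zero, neg_sub, ← h, geoDist_eq_zero_iff, eq_comm, neg_eq_iff_eq_neg]

theorem geoDist_triangle (x y z : Sph d) : geoDist x z ≤ geoDist x y + geoDist y z := by
  simp only [geoDist_eq_angle]
  exact InnerProductGeometry.angle_le_angle_add_angle _ _ _

@[fun_prop]
theorem continuous_geoDist : Continuous fun p : Sph d × Sph d => geoDist p.1 p.2 := by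
  unfold geoDist
  exact Real.continuous_arccos.comp (by fun_prop)

theorem sin_geoDist_nonneg (x y : Sph d) : 0 ≤ Real.sin (geoDist x y) :=
  Real.sin_nonneg_of_nonneg_of_le_pi (geoDist_nonneg _ _) (geoDist_le_pi _ _)

theorem sin_geoDist_pos {x y : Sph d} (h1 : y ≠ x) (h2 : y ≠ -x) :
    0 < Real.sin (geoDist x y) := by
  refine Real.sin_pos_of_pos_of_lt_pi ?_ ?_
  · exact lt_of_le_of_ne (geoDist_nonneg _ _) fun h => h1 (geoDist_eq_zero_iff.1 h.symm).symm
  · exact lt_of_le_of_ne (geoDist_le_pi _ _) fun h => h2 (geoDist_eq_pi_iff.1 h)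

theorem norm_sub_cos_smul (x y : Sph d) :
    ‖(y : EuclideanSpace ℝ (Fin d)) - Real.cos (geoDist x y) • (x : EuclideanSpace ℝ (Fin d))‖ =
      Real.sin (geoDist x y) := by
  have hx := norm_eq_of_mem_sphere x
  have hy := norm_eq_of_mem_sphere y
  rw [← sq_eq_sq₀ (norm_nonneg _) (sin_geoDist_nonneg _ _), norm_sub_sq_real, inner_smul_right,
    norm_smul, hx, hy, real_inner_comm, ← cos_geoDist, Real.norm_eq_abs, mul_one, sq_abs,
    Real.sin_sq]
  ring

@[simp] theorem logVec_self (x : Sph d) : logVec x x = 0 := by simp [logVec]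

@[simp] theorem logVec_neg (x : Sph d) : logVec x (-x) = 0 := by
  have h : geoDist x (-x) = Real.pi := geoDist_eq_pi_iff.2 rfl
  -- The scalar is `π / sin π`, a division by zero, hence `0`.
  simp [logVec, h]

theorem norm_logVec {x y : Sph d} (h : y ≠ -x) : ‖logVec x y‖ = geoDist x y := by
  by_cases hxy : y = x
  · simp [hxy]
  have hs := sin_geoDist_pos hxy h
  rw [logVec, norm_smul, norm_sub_cos_smul, norm_div, Real.norm_eq_abs, Real.norm_eq_abs,
    abs_of_nonneg (geoDist_nonneg _ _), abs_of_pos hs]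
  field_simp

theorem norm_logVec_le_geoDist (x y : Sph d) : ‖logVec x y‖ ≤ geoDist x y := by
  by_cases h : y = -x
  · rw [h, logVec_neg, norm_zero]
    exact geoDist_nonneg _ _
  · exact (norm_logVec h).le

theorem norm_logVec_le (x y : Sph d) : ‖logVec x y‖ ≤ Real.pi :=
  (norm_logVec_le_geoDist x y).trans (geoDist_le_pi _ _)

theorem inner_logVec_left {x y : Sph d} {v : EuclideanSpace ℝ (Fin d)}
    (hv : ⟪(x : EuclideanSpace ℝ (Fin d)), v⟫_ℝ = 0) :
    ⟪logVec x y, v⟫_ℝ = geoDist x y / Real.sin (geoDist x y) *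
      ⟪(y : EuclideanSpace ℝ (Fin d)), v⟫_ℝ := by
  rw [logVec, inner_smul_left, inner_sub_left, inner_smul_left, hv]
  simp

theorem expVec_logVec {x z : Sph d} (h : z ≠ -x) :
    expVec x (logVec x z) = (z : EuclideanSpace ℝ (Fin d)) := by
  by_cases hxz : z = x
  · simp [hxz, expVec]
  have hs := sin_geoDist_pos hxz h
  have hθ : geoDist x z ≠ 0 := fun h => hxz (geoDist_eq_zero_iff.1 h).symm
  rw [expVec, norm_logVec h, logVec, smul_smul]
  rw [show Real.sin (geoDist x z) / geoDist x z * (geoDist x z / Real.sin (geoDist x z)) = 1 by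
    field_simp]
  simp

/-! ### Semiconcavity of the squared distance. -/

/-- With `θ = arccos u` the derivative is `-2 θ / sin θ`. By concavity of the sine, `θ / sin θ`
increases in `θ`, and `θ` decreases in `u`. -/
theorem convexOn_arccos_sq : ConvexOn ℝ (Set.Icc (-1 : ℝ) 1) fun u => Real.arccos u ^ 2 := by
  have hd : ∀ u ∈ Set.Ioo (-1 : ℝ) 1,
      HasDerivAt (fun u => Real.arccos u ^ 2) (-(2 * (Real.arccos u / √(1 - u ^ 2)))) u := by
    intro u hu
    have := (Real.hasDerivAt_arccos hu.1.ne' hu.2.ne).pow 2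
    refine HasDerivAt.congr_deriv this ?_
    simp only [Nat.cast_ofNat, Nat.add_one_sub_one, pow_one]
    ring
  refine MonotoneOn.convexOn_of_deriv (convex_Icc _ _) (by fun_prop) ?_ ?_
  · rw [interior_Icc]
    intro u hu
    exact (hd u hu).differentiableAt.differentiableWithinAt
  · rw [interior_Icc]
    intro u hu v hv huv
    rw [(hd u hu).deriv, (hd v hv).deriv, neg_le_neg_iff]
    rcases huv.eq_or_lt with rfl | huv
    · exact le_rfl
    have key : ∀ w ∈ Set.Ioo (-1 : ℝ) 1, 0 < Real.arccos w ∧ Real.arccos w < Real.pi := by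
      intro w hw
      refine ⟨Real.arccos_pos.2 hw.2, ?_⟩
      refine lt_of_le_of_ne (Real.arccos_le_pi _) fun h => ?_
      exact absurd (Real.arccos_eq_pi.1 h) (not_le.2 hw.1)
    rw [← Real.sin_arccos, ← Real.sin_arccos]
    obtain ⟨hu0, hu1⟩ := key u hu
    obtain ⟨hv0, hv1⟩ := key v hv
    have hlt : Real.arccos v < Real.arccos u :=
      Real.strictAntiOn_arccos (Set.Ioo_subset_Icc_self hu) (Set.Ioo_subset_Icc_self hv) huv
    have hsl := (strictConcaveOn_sin_Icc).concaveOn.slope_anti_adjacent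
      (x := 0) (y := Real.arccos v) (z := Real.arccos u) ⟨le_rfl, Real.pi_pos.le⟩
      ⟨hu0.le, hu1.le⟩ hv0 hlt
    have su := Real.sin_pos_of_pos_of_lt_pi hu0 hu1
    have sv := Real.sin_pos_of_pos_of_lt_pi hv0 hv1
    rw [Real.sin_zero, sub_zero, sub_zero, div_le_div_iff₀ (by linarith) hv0] at hsl
    rw [mul_le_mul_iff_right₀ two_pos, div_le_div_iff₀ sv su]
    nlinarith

theorem arccos_cos_sq_le (t : ℝ) : Real.arccos (Real.cos t) ^ 2 ≤ t ^ 2 := by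
  rw [← Real.cos_abs, ← sq_abs t]
  refine pow_le_pow_left₀ (Real.arccos_nonneg _) ?_ 2
  rcases le_total |t| Real.pi with h | h
  · rw [Real.arccos_cos (abs_nonneg _) h]
  · exact (Real.arccos_le_pi _).trans h

/-- A spherical triangle with sides `a`, `b` and angle of cosine `k` between them is thinner than
the Euclidean one. -/
theorem arccos_sq_le_of_cosine_law (a b : ℝ) {k : ℝ} (hk : k ∈ Set.Icc (-1 : ℝ) 1) :
    Real.arccos (Real.cos a * Real.cos b + Real.sin a * Real.sin b * k) ^ 2 ≤
      a ^ 2 + b ^ 2 - 2 * a * b * k := by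
  have h1 : Real.cos (a + b) ∈ Set.Icc (-1 : ℝ) 1 := ⟨Real.neg_one_le_cos _, Real.cos_le_one _⟩
  have h2 : Real.cos (a - b) ∈ Set.Icc (-1 : ℝ) 1 := ⟨Real.neg_one_le_cos _, Real.cos_le_one _⟩
  -- The spherical cosine law is affine in `k`, so it interpolates between the degenerate triangles
  -- `cos (a + b)` and `cos (a - b)`. The same weights applied to `(a + b) ^ 2` and `(a - b) ^ 2`
  -- give the Euclidean law.
  have hc := convexOn_arccos_sq.2 h1 h2 (show 0 ≤ (1 - k) / 2 by linarith [hk.2])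
    (show 0 ≤ (1 + k) / 2 by linarith [hk.1]) (by ring)
  simp only [smul_eq_mul] at hc
  have he : (1 - k) / 2 * Real.cos (a + b) + (1 + k) / 2 * Real.cos (a - b) =
      Real.cos a * Real.cos b + Real.sin a * Real.sin b * k := by
    rw [Real.cos_add, Real.cos_sub]; ring
  rw [he] at hc
  have hA := mul_le_mul_of_nonneg_left (arccos_cos_sq_le (a + b))
    (show 0 ≤ (1 - k) / 2 by linarith [hk.2])
  have hB := mul_le_mul_of_nonneg_left (arccos_cos_sq_le (a - b))
    (show 0 ≤ (1 + k) / 2 by linarith [hk.1])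
  nlinarith

/-- The squared distance to `y` is semiconcave along the exponential map. -/
theorem half_geoDist_sq_le {x y z : Sph d} (hxy : y ≠ -x) {v : EuclideanSpace ℝ (Fin d)}
    (hv : ⟪(x : EuclideanSpace ℝ (Fin d)), v⟫_ℝ = 0)
    (hz : (z : EuclideanSpace ℝ (Fin d)) = expVec x v) :
    1 / 2 * geoDist y z ^ 2 ≤
      1 / 2 * geoDist y x ^ 2 - ⟪logVec x y, v⟫_ℝ + 1 / 2 * ‖v‖ ^ 2 := by
  by_cases hv0 : v = 0
  · have : z = x := Subtype.ext (by simp [hz, hv0, expVec])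
    simp [this, hv0]
  have hb : 0 < ‖v‖ := norm_pos_iff.2 hv0
  set w : EuclideanSpace ℝ (Fin d) :=
    (y : EuclideanSpace ℝ (Fin d)) - Real.cos (geoDist x y) • (x : EuclideanSpace ℝ (Fin d)) with hw
  have hwv : ⟪(y : EuclideanSpace ℝ (Fin d)), v⟫_ℝ = ⟪w, v⟫_ℝ := by
    rw [hw, inner_sub_left, inner_smul_left, hv]; simp
  have hwn : ‖w‖ = Real.sin (geoDist x y) := norm_sub_cos_smul x y
  have habs := abs_real_inner_le_norm w v
  have hyz : ⟪(y : EuclideanSpace ℝ (Fin d)), z⟫_ℝ =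
      Real.cos (geoDist x y) * Real.cos ‖v‖ + Real.sin ‖v‖ / ‖v‖ * ⟪w, v⟫_ℝ := by
    rw [hz, expVec, inner_add_right, inner_smul_right, inner_smul_right, hwv, real_inner_comm,
      ← cos_geoDist]
    ring
  -- `k` is the cosine of the angle at `x` between `y` and `v`. If `y = x` there is no such angle,
  -- but both inner products vanish and `k = 0` serves.
  have hmain : ∃ k ∈ Set.Icc (-1 : ℝ) 1, ⟪w, v⟫_ℝ = Real.sin (geoDist x y) * ‖v‖ * k ∧
      ⟪logVec x y, v⟫_ℝ = geoDist x y * ‖v‖ * k := by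
    by_cases hyx : y = x
    · refine ⟨0, by simp, ?_, by simp [hyx]⟩
      rw [← hwv, hyx, hv]; simp
    · have hs := sin_geoDist_pos hyx hxy
      refine ⟨⟪w, v⟫_ℝ / (Real.sin (geoDist x y) * ‖v‖), ?_, ?_, ?_⟩
      · rw [← hwn, Set.mem_Icc, ← abs_le]
        exact abs_real_inner_div_norm_mul_norm_le_one _ _
      · field_simp
      · rw [inner_logVec_left hv, hwv]
        field_simp
  obtain ⟨k, hk, h1, h2⟩ := hmain
  have := arccos_sq_le_of_cosine_law (geoDist x y) ‖v‖ hk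
  have harg : ⟪(y : EuclideanSpace ℝ (Fin d)), z⟫_ℝ = Real.cos (geoDist x y) * Real.cos ‖v‖ +
      Real.sin (geoDist x y) * Real.sin ‖v‖ * k := by
    rw [hyz, h1]
    field_simp
  rw [← harg] at this
  rw [h2, geoDist_comm y x]
  change geoDist y z ^ 2 ≤ _ at this
  linarith

theorem half_geoDist_sq_le_logVec {x y z : Sph d} (hxy : y ≠ -x) (hxz : z ≠ -x) :
    1 / 2 * geoDist y z ^ 2 ≤
      1 / 2 * geoDist y x ^ 2 - ⟪logVec x y, logVec x z⟫_ℝ + 1 / 2 * geoDist x z ^ 2 := by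
  have := half_geoDist_sq_le hxy (inner_logVec x z) (expVec_logVec hxz).symm
  rwa [norm_logVec hxz] at this

/-! ### Remainder, continuity and measurability estimates. -/

theorem abs_sin_sub_self_le {b : ℝ} (hb : 0 ≤ b) : |Real.sin b - b| ≤ 2 * b ^ 2 := by
  rw [abs_sub_comm, abs_of_nonneg (by linarith [Real.sin_le hb])]
  rcases hb.eq_or_lt with rfl | hb0
  · simp
  rcases le_total b 1 with h | h
  · have := Real.sin_gt_sub_cube hb0
    nlinarith [pow_pos hb0 2]
  · nlinarith [Real.neg_one_le_sin b]

theorem norm_expVec_sub_le (x : Sph d) (v : EuclideanSpace ℝ (Fin d)) :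
    ‖expVec x v - x - v‖ ≤ 3 * ‖v‖ ^ 2 := by
  by_cases hv : v = 0
  · simp [hv, expVec]
  have hb : 0 < ‖v‖ := norm_pos_iff.2 hv
  have he : expVec x v - x - v = (Real.cos ‖v‖ - 1) • (x : EuclideanSpace ℝ (Fin d)) +
      ((Real.sin ‖v‖ - ‖v‖) / ‖v‖) • v := by
    rw [expVec, sub_div, div_self hb.ne']
    module
  rw [he]
  refine (norm_add_le _ _).trans ?_
  rw [norm_smul, norm_smul, norm_eq_of_mem_sphere, norm_div, norm_norm, Real.norm_eq_abs,
    Real.norm_eq_abs, div_mul_cancel₀ _ hb.ne', mul_one]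
  have h1 := abs_sin_sub_self_le hb.le
  have h2 : |Real.cos ‖v‖ - 1| ≤ ‖v‖ ^ 2 / 2 := by
    rw [abs_sub_comm, abs_of_nonneg (by linarith [Real.cos_le_one ‖v‖])]
    linarith [Real.one_sub_sq_div_two_le_cos (x := ‖v‖)]
  nlinarith [sq_nonneg ‖v‖]

theorem continuousAt_logVec {x y : Sph d} (h1 : y ≠ x) (h2 : y ≠ -x) :
    ContinuousAt (fun p : Sph d × Sph d => logVec p.1 p.2) (x, y) := by
  have hs := sin_geoDist_pos h1 h2
  have hg : ContinuousAt (fun p : Sph d × Sph d => geoDist p.1 p.2) (x, y) :=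
    continuous_geoDist.continuousAt
  unfold logVec
  refine ContinuousAt.smul (hg.div (Real.continuous_sin.continuousAt.comp hg) hs.ne') ?_
  exact (by fun_prop : Continuous fun p : Sph d × Sph d =>
    (p.2 : EuclideanSpace ℝ (Fin d)) -
      Real.cos (geoDist p.1 p.2) • (p.1 : EuclideanSpace ℝ (Fin d))).continuousAt

theorem _root_.Filter.Tendsto.geoDist {α : Type*} {l : Filter α} {f g : α → Sph d} {x y : Sph d}
    (hf : Tendsto f l (𝓝 x)) (hg : Tendsto g l (𝓝 y)) :
    Tendsto (fun a => geoDist (f a) (g a)) l (𝓝 (geoDist x y)) := by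
  have h := ((continuous_geoDist (d := d)).tendsto (x, y)).comp (hf.prodMk_nhds hg)
  rwa [Function.comp_def] at h

theorem _root_.Measurable.geoDist {α : Type*} [MeasurableSpace α] {f g : α → Sph d}
    (hf : Measurable f) (hg : Measurable g) : Measurable fun a => geoDist (f a) (g a) := by
  have h := (continuous_geoDist (d := d)).measurable.comp (hf.prodMk hg)
  rwa [Function.comp_def] at h

theorem _root_.Measurable.logVec {α : Type*} [MeasurableSpace α] {f g : α → Sph d}
    (hf : Measurable f) (hg : Measurable g) : Measurable fun a => logVec (f a) (g a) := by
  have h := hf.geoDist hg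
  exact (h.div (Real.measurable_sin.comp h)).smul
    (hg.subtype_val.sub ((Real.measurable_cos.comp h).smul hf.subtype_val))

/-- For an acute angle, `sin α` is the distance from `x` to the line of `z`, and Jordan's inequality
compares it with `α`. Otherwise `z` is at distance at least 1 from `x`. This supplies the domination
for differentiating under the integral. -/
theorem angle_le_pi_mul_norm_sub {E : Type*} [NormedAddCommGroup E] [InnerProductSpace ℝ E]
    {x : E} (hx : ‖x‖ = 1) (z : E) :
    InnerProductGeometry.angle z x ≤ Real.pi * ‖z - x‖ := by
  set α := InnerProductGeometry.angle z x with hα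
  have h0 : 0 ≤ α := InnerProductGeometry.angle_nonneg _ _
  have h1 : α ≤ Real.pi := InnerProductGeometry.angle_le_pi _ _
  have hsq : ‖z - x‖ ^ 2 = ‖z‖ ^ 2 - 2 * (Real.cos α * ‖z‖) + 1 := by
    have := InnerProductGeometry.cos_angle_mul_norm_mul_norm z x
    rw [hx, mul_one] at this
    rw [norm_sub_sq_real, hx, ← this]
    ring
  have hz := norm_nonneg z
  rcases le_total α (Real.pi / 2) with h | h
  · have hs := Real.mul_le_sin h0 h
    have hle : Real.sin α ≤ ‖z - x‖ := by
      refine le_of_sq_le_sq ?_ (norm_nonneg _)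
      rw [hsq]
      nlinarith [sq_nonneg (‖z‖ - Real.cos α), Real.sin_sq_add_cos_sq α]
    have : α = Real.pi / 2 * (2 / Real.pi * α) := by field_simp
    have hp := Real.pi_pos
    nlinarith [norm_nonneg (z - x)]
  · have hc := Real.cos_nonpos_of_pi_div_two_le_of_le h (by linarith [Real.pi_pos])
    have hle : 1 ≤ ‖z - x‖ := by
      refine le_of_sq_le_sq ?_ (norm_nonneg _)
      rw [hsq]
      nlinarith
    nlinarith [Real.pi_pos]

/-! ### Null sets of the uniform distribution and generic points. -/

open Pointwise in
theorem volume_cone_eq_zero {x : EuclideanSpace ℝ (Fin d)} (hd : 2 ≤ d) (hx : ‖x‖ = 1) (c : ℝ) :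
    volume {z : EuclideanSpace ℝ (Fin d) | ⟪x, z⟫_ℝ = c * ‖z‖} = 0 := by
  set A := {z : EuclideanSpace ℝ (Fin d) | ⟪x, z⟫_ℝ = c * ‖z‖} with hA
  have hAm : MeasurableSet A :=
    measurableSet_eq_fun (by fun_prop : Continuous _).measurable
      (by fun_prop : Continuous _).measurable
  rcases lt_or_ge |c| 1 with hc | hc
  -- Shifting by `r • x` changes the inner product by `r` but `c * ‖z‖` by at most `|c| * |r| <
  -- |r|`, so distinct translates are disjoint. Uncountably many of them have equal measure, which
  -- must be zero.
  · have hdisj : Pairwise (Function.onFun Disjoint fun ε : ℝ => (ε • x) +ᵥ A) := by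
      intro ε δ hne
      rw [Function.onFun, Set.disjoint_left]
      rintro _ ⟨a, ha, rfl⟩ ⟨b, hb, hab⟩
      simp only [vadd_eq_add] at hab
      simp only [hA, Set.mem_ofPred_eq] at ha hb
      have hb' : b = a + (ε - δ) • x := by
        rw [eq_sub_of_add_eq' hab, sub_smul]; abel
      rw [hb', inner_add_right, inner_smul_right, ha, real_inner_self_eq_norm_sq, hx] at hb
      have h1 : ε - δ = c * (‖a + (ε - δ) • x‖ - ‖a‖) := by linarith
      have h2 : |‖a + (ε - δ) • x‖ - ‖a‖| ≤ |ε - δ| := by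
        refine (abs_norm_sub_norm_le _ _).trans ?_
        rw [add_sub_cancel_left, norm_smul, hx, mul_one, Real.norm_eq_abs]
      have h3 : |ε - δ| ≤ |c| * |ε - δ| := by
        conv_lhs => rw [h1, abs_mul]
        exact mul_le_mul_of_nonneg_left h2 (abs_nonneg _)
      have h4 : 0 < |ε - δ| := abs_pos.2 (sub_ne_zero.2 hne)
      nlinarith
    have hcount := Measure.countable_meas_pos_of_disjoint_iUnion
      (μ := (volume : Measure (EuclideanSpace ℝ (Fin d)))) (fun ε : ℝ => hAm.const_vadd (ε • x)) hdisj
    by_contra hne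
    simp only [measure_vadd] at hcount
    have hun : {i : ℝ | 0 < volume A} = Set.univ := by
      ext; simp [pos_iff_ne_zero, hne]
    rw [hun] at hcount
    exact Cardinal.not_countable_real hcount
  -- For `|c| ≥ 1`, membership forces equality in Cauchy–Schwarz, so the cone lies in a line, a
  -- proper subspace as `d ≥ 2`.
  · have hsub : A ⊆ (Submodule.span ℝ {x} : Submodule ℝ (EuclideanSpace ℝ (Fin d))) := by
      intro z hz
      have hz' : ⟪x, z⟫_ℝ = c * ‖z‖ := hz
      have h1 := abs_real_inner_le_norm x z
      have h2 : |⟪x, z⟫_ℝ| = ‖x‖ * ‖z‖ := by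
        refine le_antisymm h1 ?_
        rw [hz', abs_mul, hx, abs_norm]
        exact mul_le_mul_of_nonneg_right hc (norm_nonneg _)
      have hx0 : x ≠ 0 := by rw [← norm_pos_iff, hx]; exact one_pos
      obtain rfl | hz0 := eq_or_ne z 0
      · exact Submodule.zero_mem _
      have h3 : |⟪x, z⟫_ℝ / (‖x‖ * ‖z‖)| = 1 := by
        rw [abs_div, h2, abs_of_nonneg (by positivity : 0 ≤ ‖x‖ * ‖z‖)]
        exact div_self (by positivity)
      obtain ⟨-, r, -, hr⟩ := (abs_real_inner_div_norm_mul_norm_eq_one_iff x z).1 h3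
      exact Submodule.mem_span_singleton.2 ⟨r, hr.symm⟩
    refine measure_mono_null hsub (Measure.addHaar_submodule _ _ ?_)
    intro htop
    have := finrank_span_singleton (K := ℝ) (v := x) (by rw [← norm_pos_iff, hx]; exact one_pos)
    rw [htop, finrank_top, finrank_euclideanSpace_fin] at this
    omega

theorem unif_inner_eq (hd : 2 ≤ d) {x : EuclideanSpace ℝ (Fin d)} (hx : ‖x‖ = 1) (c : ℝ) :
    unif d {y | ⟪x, (y : EuclideanSpace ℝ (Fin d))⟫_ℝ = c} = 0 := by
  have hm : MeasurableSet {y : Sph d | ⟪x, (y : EuclideanSpace ℝ (Fin d))⟫_ℝ = c} :=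
    measurableSet_eq_fun (by fun_prop : Continuous _).measurable measurable_const
  rw [unif, Measure.smul_apply, Measure.toSphere_apply' _ hm, measure_mono_null _
    (volume_cone_eq_zero hd hx c)]
  · simp
  · rintro _ ⟨r, hr, _, ⟨y, hy, rfl⟩, rfl⟩
    simp only [Set.mem_ofPred_eq] at hy ⊢
    simp only [inner_smul_right, hy, norm_smul, norm_eq_of_mem_sphere,
      Real.norm_eq_abs, abs_of_pos hr.1]
    ring

theorem isProbabilityMeasure_unif (hd : 2 ≤ d) : IsProbabilityMeasure (unif d) := by
  have : Nontrivial (EuclideanSpace ℝ (Fin d)) := by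
    apply Module.nontrivial_of_finrank_pos (R := ℝ)
    rw [finrank_euclideanSpace_fin]; omega
  constructor
  rw [unif, Measure.smul_apply, smul_eq_mul]
  refine ENNReal.inv_mul_cancel ?_ (measure_ne_top _ _)
  rw [Ne, Measure.measure_univ_eq_zero]
  exact Measure.toSphere_ne_zero _

theorem unif_pos_of_isOpen {U : Set (Sph d)} (hU : IsOpen U) (hne : U.Nonempty) :
    0 < unif d U := by
  rw [unif, Measure.smul_apply, smul_eq_mul]
  refine ENNReal.mul_pos ?_ (hU.measure_pos _ hne).ne'
  exact ENNReal.inv_ne_zero.2 (measure_ne_top _ _)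

theorem ae_inner_ne (hd : 2 ≤ d) (x : Sph d) (c : ℝ) :
    ∀ᵐ y : Sph d ∂unif d, ⟪(x : EuclideanSpace ℝ (Fin d)), y⟫_ℝ ≠ c := by
  rw [ae_iff]
  simpa using unif_inner_eq hd (x := (x : EuclideanSpace ℝ (Fin d))) (by simp) c

theorem ae_ne (hd : 2 ≤ d) (x : Sph d) : ∀ᵐ y ∂unif d, y ≠ x := by
  filter_upwards [ae_inner_ne hd x 1] with y hy h
  rw [h, inner_self_sph] at hy
  exact hy rfl

theorem ae_geoDist_ne (hd : 2 ≤ d) {x z : Sph d} (h : x ≠ z) :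
    ∀ᵐ y ∂unif d, geoDist y x ≠ geoDist y z := by
  have hne : (x : EuclideanSpace ℝ (Fin d)) - z ≠ 0 := sub_ne_zero.2 fun h' => h (Subtype.ext h')
  have h0 := unif_inner_eq hd (norm_smul_inv_norm (𝕜 := ℝ) hne) 0
  rw [ae_iff]
  refine measure_mono_null ?_ h0
  intro y hy
  simp only [Set.mem_ofPred_eq, not_not] at hy ⊢
  have := congrArg Real.cos hy
  rw [cos_geoDist, cos_geoDist, real_inner_comm, real_inner_comm _ (y : EuclideanSpace ℝ (Fin d))]
    at this
  rw [inner_smul_left, inner_sub_left, this, sub_self, mul_zero]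

/-- `y` is in generic position with respect to the configuration `X`. -/
def Generic (X : Fin n → Sph d) (y : Sph d) : Prop :=
  (∀ i, y ≠ X i ∧ y ≠ -X i) ∧ ∀ i j, i ≠ j → geoDist y (X i) ≠ geoDist y (X j)

theorem ae_generic (hd : 2 ≤ d) {X : Fin n → Sph d} (hX : Function.Injective X) :
    ∀ᵐ y ∂unif d, Generic X y := by
  refine (ae_all_iff.2 fun i => (ae_ne hd _).and (ae_ne hd _)).and ?_
  refine ae_all_iff.2 fun i => ae_all_iff.2 fun j => ?_
  by_cases hij : i = j
  · exact Eventually.of_forall fun y h => absurd hij h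
  · filter_upwards [ae_geoDist_ne hd (hX.ne hij)] with y hy _
    exact hy

/-! ### Bounds, measurability and mean of the stochastic gradient. -/

theorem norm_Qi_le (X : Fin n → Sph d) (y : Sph d) (i : Fin n) : ‖Qi X y i‖ ≤ Real.pi := by
  unfold Qi
  split_ifs
  · exact norm_logVec_le _ _
  · simpa using Real.pi_pos.le

theorem norm_Qi {X : Fin n → Sph d} {y : Sph d} {i : Fin n} (h : y ≠ -X i) :
    ‖Qi X y i‖ = geoDist (X i) y * (voronoi X i).indicator (fun _ => (1 : ℝ)) y := by
  unfold Qi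
  split_ifs with hy
  · simp [hy, norm_logVec h]
  · simp [hy]

theorem norm_le_of_forall_norm_le {v : Amb d n} {C : ℝ} (hC : 0 ≤ C) (h : ∀ i, ‖v i‖ ≤ C) :
    ‖v‖ ≤ C * √(n : ℝ) := by
  refine le_of_sq_le_sq ?_ (by positivity)
  rw [PiLp.norm_sq_eq_of_L2, mul_pow, Real.sq_sqrt (Nat.cast_nonneg _)]
  calc ∑ i, ‖v i‖ ^ 2 ≤ ∑ _i : Fin n, C ^ 2 :=
        Finset.sum_le_sum fun i _ => pow_le_pow_left₀ (norm_nonneg _) (h i) 2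
    _ = C ^ 2 * n := by simp [mul_comm]

theorem norm_Q_le (X : Fin n → Sph d) (y : Sph d) : ‖Q X y‖ ≤ Real.pi * √(n : ℝ) :=
  norm_le_of_forall_norm_le Real.pi_pos.le fun i => norm_Qi_le X y i

theorem _root_.Measurable.Qi {α : Type*} [MeasurableSpace α] {f : α → Fin n → Sph d}
    {g : α → Sph d} (hf : Measurable f) (hg : Measurable g) (i : Fin n) :
    Measurable fun a => Qi (f a) (g a) i := by
  have hX : ∀ k : Fin n, Measurable fun a => f a k := fun k => (measurable_pi_apply k).comp hf
  have hs : MeasurableSet {a | g a ∈ voronoi (f a) i} := by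
    have he : {a | g a ∈ voronoi (f a) i} = ⋂ j, ⋂ _ : j ≠ i,
        {a | geoDist (g a) (f a i) ≤ geoDist (g a) (f a j)} := by
      ext a
      simp [voronoi]
    rw [he]
    exact MeasurableSet.iInter fun j => MeasurableSet.iInter fun _ =>
      measurableSet_le (hg.geoDist (hX i)) (hg.geoDist (hX j))
  exact Measurable.ite hs ((hX i).logVec hg) measurable_const

theorem _root_.Measurable.lloydQ {α : Type*} [MeasurableSpace α] {f : α → Fin n → Sph d}
    {g : α → Sph d} (hf : Measurable f) (hg : Measurable g) :
    Measurable fun a => Q (f a) (g a) :=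
  (WithLp.measurable_toLp 2 _).comp (measurable_pi_lambda _ fun i => hf.Qi hg i)

theorem measurable_Q_right (X : Fin n → Sph d) : Measurable (Q X) :=
  measurable_const.lloydQ measurable_id

theorem integrable_Q (hd : 2 ≤ d) (X : Fin n → Sph d) : Integrable (Q X) (unif d) := by
  have := isProbabilityMeasure_unif hd
  exact Integrable.of_bound (measurable_Q_right X).aestronglyMeasurable _
    (Eventually.of_forall (norm_Q_le X))

theorem integrable_Qi (hd : 2 ≤ d) (X : Fin n → Sph d) (i : Fin n) :
    Integrable (fun y => Qi X y i) (unif d) := by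
  have := isProbabilityMeasure_unif hd
  exact Integrable.of_bound (measurable_const.Qi measurable_id i).aestronglyMeasurable _
    (Eventually.of_forall fun y => norm_Qi_le X y i)

/-- The mean of `Q X`, that is, minus the gradient of the Lloyd objective. -/
noncomputable def meanQ (X : Fin n → Sph d) : Amb d n := ∫ y, Q X y ∂unif d

theorem norm_meanQ_le (hd : 2 ≤ d) (X : Fin n → Sph d) : ‖meanQ X‖ ≤ Real.pi * √(n : ℝ) := by
  have := isProbabilityMeasure_unif hd
  simpa [meanQ] using
    norm_integral_le_of_norm_le_const (μ := unif d) (Eventually.of_forall (norm_Q_le X))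

theorem meanQ_apply (hd : 2 ≤ d) (X : Fin n → Sph d) (i : Fin n) :
    meanQ X i = ∫ y, Qi X y i ∂unif d :=
  ((PiLp.proj (𝕜 := ℝ) 2 (fun _ : Fin n => EuclideanSpace ℝ (Fin d)) i).integral_comp_comm
    (integrable_Q hd X)).symm

theorem inner_meanQ (hd : 2 ≤ d) (X : Fin n → Sph d) (i : Fin n) :
    ⟪(X i : EuclideanSpace ℝ (Fin d)), meanQ X i⟫_ℝ = 0 := by
  rw [meanQ_apply hd, ← integral_inner (integrable_Qi hd X i)]
  simp [inner_Qi]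

theorem exists_forall_geoDist_le (hn : 1 ≤ n) (X : Fin n → Sph d) (y : Sph d) :
    ∃ i, ∀ j, geoDist y (X i) ≤ geoDist y (X j) := by
  have : Nonempty (Fin n) := ⟨⟨0, hn⟩⟩
  exact Finite.exists_min _

theorem Generic.lt {X : Fin n → Sph d} {y : Sph d} (h : Generic X y) {i : Fin n}
    (hi : ∀ j, geoDist y (X i) ≤ geoDist y (X j)) {j : Fin n} (hj : j ≠ i) :
    geoDist y (X i) < geoDist y (X j) :=
  lt_of_le_of_ne (hi j) (h.2 i j hj.symm)

theorem Qi_eq_logVec {X : Fin n → Sph d} {y : Sph d} {i : Fin n}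
    (hi : ∀ j, geoDist y (X i) ≤ geoDist y (X j)) : Qi X y i = logVec (X i) y :=
  if_pos fun j _ => hi j

theorem Generic.Qi_eq_zero {X : Fin n → Sph d} {y : Sph d} (h : Generic X y) {i : Fin n}
    (hi : ∀ j, geoDist y (X i) ≤ geoDist y (X j)) {j : Fin n} (hj : j ≠ i) : Qi X y j = 0 := by
  rw [Qi, if_neg fun hy => (h.lt hi hj).not_ge (hy i hj.symm)]

theorem Generic.inner_Q {X : Fin n → Sph d} {y : Sph d} (h : Generic X y) {i : Fin n}
    (hi : ∀ j, geoDist y (X i) ≤ geoDist y (X j)) (v : Amb d n) :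
    ⟪Q X y, v⟫_ℝ = ⟪logVec (X i) y, v i⟫_ℝ := by
  rw [PiLp.inner_apply, Finset.sum_eq_single i]
  · simp [Q, Qi_eq_logVec hi]
  · intro j _ hj
    simp [Q, h.Qi_eq_zero hi hj]
  · simp

theorem ciInf_half_sq_eq {ι : Type*} [Finite ι] {f : ι → ℝ} (hf : ∀ j, 0 ≤ f j) {i : ι}
    (hi : ∀ j, f i ≤ f j) : ⨅ j, (1 / 2 : ℝ) * f j ^ 2 = 1 / 2 * f i ^ 2 := by
  have : Nonempty ι := ⟨i⟩
  refine le_antisymm (ciInf_le (Set.finite_range _).bddBelow i) (le_ciInf fun j => ?_)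
  have := pow_le_pow_left₀ (hf i) (hi j) 2
  linarith

theorem abs_ciInf_sub_ciInf_le {ι : Type*} [Finite ι] [Nonempty ι] {f g : ι → ℝ} {C : ℝ}
    (h : ∀ i, |f i - g i| ≤ C) : |(⨅ i, f i) - ⨅ i, g i| ≤ C := by
  rw [abs_sub_le_iff]
  constructor
  · rw [sub_le_iff_le_add, ← sub_le_iff_le_add']
    refine le_ciInf fun i => ?_
    have := ciInf_le (Set.finite_range f).bddBelow i
    linarith [(abs_le.1 (h i)).2]
  · rw [sub_le_iff_le_add, ← sub_le_iff_le_add']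
    refine le_ciInf fun i => ?_
    have := ciInf_le (Set.finite_range g).bddBelow i
    linarith [(abs_le.1 (h i)).1]

/-! ### Differentiating the objective. -/

open InnerProductGeometry in
theorem hasFDerivAt_half_angle_sq {x y : Sph d} (h1 : y ≠ x) (h2 : y ≠ -x) :
    HasFDerivAt (fun z : EuclideanSpace ℝ (Fin d) =>
      1 / 2 * angle (y : EuclideanSpace ℝ (Fin d)) z ^ 2)
      (-innerSL ℝ (logVec x y)) (x : EuclideanSpace ℝ (Fin d)) := by
  have hx := norm_eq_of_mem_sphere x
  have hs := sin_geoDist_pos h1 h2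
  -- The angle is `arccos` of an inner product divided by norms. The norm is written as a square
  -- root to reach its derivative through that of the squared norm.
  have hn1 : HasFDerivAt (fun z : EuclideanSpace ℝ (Fin d) => √(‖z‖ ^ 2))
      ((1 / (2 * √(‖(x : EuclideanSpace ℝ (Fin d))‖ ^ 2))) •
        (2 • innerSL ℝ (x : EuclideanSpace ℝ (Fin d)))) (x : EuclideanSpace ℝ (Fin d)) :=
    (hasStrictFDerivAt_norm_sq (x : EuclideanSpace ℝ (Fin d))).hasFDerivAt.sqrt (by simp [hx])
  have hinv := (hasDerivAt_inv (x := √(‖(x : EuclideanSpace ℝ (Fin d))‖ ^ 2))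
    (by simp [hx])).comp_hasFDerivAt (x : EuclideanSpace ℝ (Fin d)) hn1
  have hu := ((innerSL ℝ (y : EuclideanSpace ℝ (Fin d))).hasFDerivAt
    (x := (x : EuclideanSpace ℝ (Fin d)))).mul hinv
  have hval : ((innerSL ℝ (y : EuclideanSpace ℝ (Fin d))) (x : EuclideanSpace ℝ (Fin d))) *
      ((fun y => y⁻¹) ∘ fun z : EuclideanSpace ℝ (Fin d) => √(‖z‖ ^ 2))
        (x : EuclideanSpace ℝ (Fin d)) = Real.cos (geoDist x y) := by
    simp [cos_geoDist, hx, real_inner_comm]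
  have hb : Real.cos (geoDist x y) ^ 2 < 1 := by
    nlinarith [Real.sin_sq_add_cos_sq (geoDist x y)]
  have hb' := abs_lt.1 ((sq_lt_one_iff_abs_lt_one _).1 hb)
  have harc := ((Real.hasDerivAt_arccos (x := Real.cos (geoDist x y)) hb'.1.ne' hb'.2.ne).pow
    2).const_mul (1 / 2 : ℝ)
  rw [← hval] at harc
  have hfin := harc.comp_hasFDerivAt (x : EuclideanSpace ℝ (Fin d)) hu
  refine (hfin.congr_fderiv ?_).congr_of_eventuallyEq ?_
  · rw [hval, Real.arccos_cos (geoDist_nonneg _ _) (geoDist_le_pi _ _), ← Real.sin_sq,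
      Real.sqrt_sq hs.le]
    ext v
    simp [hx, logVec, cos_geoDist, real_inner_comm]
    ring
  · refine Eventually.of_forall fun z => ?_
    simp [angle, div_eq_mul_inv]

/-- The integrand of the Lloyd objective, extended from configurations on the sphere to `(ℝᵈ)ⁿ`. -/
noncomputable def extCost (Z : Amb d n) (y : Sph d) : ℝ :=
  ⨅ j : Fin n, (1 / 2 : ℝ) * InnerProductGeometry.angle (y : EuclideanSpace ℝ (Fin d)) (Z j) ^ 2

theorem extCost_toAmb (X : Fin n → Sph d) (y : Sph d) :
    extCost (toAmb X) y = ⨅ j : Fin n, (1 / 2 : ℝ) * geoDist y (X j) ^ 2 := by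
  simp [extCost, toAmb, geoDist_eq_angle]

theorem measurable_extCost (Z : Amb d n) : Measurable (extCost Z) := by
  refine Measurable.iInf fun j => Measurable.const_mul (Measurable.pow_const ?_ 2) _
  simp only [InnerProductGeometry.angle, norm_eq_of_mem_sphere]
  exact Real.measurable_arccos.comp
    (by fun_prop : Continuous fun y : Sph d =>
      ⟪(y : EuclideanSpace ℝ (Fin d)), Z j⟫_ℝ / (1 * ‖Z j‖)).measurable

theorem abs_half_sq_sub_half_sq_le {a b C : ℝ} (ha : 0 ≤ a) (hb : 0 ≤ b) (ha' : a ≤ C)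
    (hb' : b ≤ C) : |1 / 2 * a ^ 2 - 1 / 2 * b ^ 2| ≤ C * |a - b| := by
  have : 1 / 2 * a ^ 2 - 1 / 2 * b ^ 2 = (a + b) / 2 * (a - b) := by ring
  rw [this, abs_mul, abs_of_nonneg (by positivity)]
  exact mul_le_mul_of_nonneg_right (by linarith) (abs_nonneg _)

open InnerProductGeometry in
theorem abs_extCost_sub_le (hn : 1 ≤ n) (Z : Amb d n) (X : Fin n → Sph d) (y : Sph d) :
    |extCost Z y - extCost (toAmb X) y| ≤ Real.pi * Real.pi * ‖Z - toAmb X‖ := by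
  have : Nonempty (Fin n) := ⟨⟨0, hn⟩⟩
  refine abs_ciInf_sub_ciInf_le fun j => ?_
  refine (abs_half_sq_sub_half_sq_le (angle_nonneg _ _) (angle_nonneg _ _)
    (angle_le_pi _ _) (angle_le_pi _ _)).trans ?_
  rw [mul_assoc]
  refine mul_le_mul_of_nonneg_left ?_ Real.pi_pos.le
  have h1 : angle (Z j) (toAmb X j) ≤ Real.pi * ‖Z j - toAmb X j‖ :=
    angle_le_pi_mul_norm_sub (norm_eq_of_mem_sphere (X j)) _
  have h2 : ‖Z j - toAmb X j‖ ≤ ‖Z - toAmb X‖ := PiLp.norm_apply_le (Z - toAmb X) j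
  have h3 := angle_le_angle_add_angle (y : EuclideanSpace ℝ (Fin d)) (toAmb X j) (Z j)
  have h4 := angle_le_angle_add_angle (y : EuclideanSpace ℝ (Fin d)) (Z j) (toAmb X j)
  rw [angle_comm (toAmb X j)] at h3
  have h5 := mul_le_mul_of_nonneg_left h2 Real.pi_pos.le
  rw [abs_le]
  constructor <;> linarith

open InnerProductGeometry in
theorem hasFDerivAt_extCost (hn : 1 ≤ n) {X : Fin n → Sph d} {y : Sph d} (h : Generic X y) :
    HasFDerivAt (fun Z => extCost Z y) (-innerSL ℝ (Q X y)) (toAmb X) := by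
  obtain ⟨i, hi⟩ := exists_forall_geoDist_le hn X y
  have hproj := (PiLp.proj (𝕜 := ℝ) 2 (fun _ : Fin n => EuclideanSpace ℝ (Fin d)) i).hasFDerivAt
    (x := toAmb X)
  have hi' := (hasFDerivAt_half_angle_sq (h.1 i).1 (h.1 i).2).comp (toAmb X) hproj
  refine (hi'.congr_fderiv ?_).congr_of_eventuallyEq ?_
  · ext v
    simpa using (h.inner_Q hi v).symm
  · have hc : ∀ j, ContinuousAt (fun Z : Amb d n =>
        angle (y : EuclideanSpace ℝ (Fin d)) (Z j)) (toAmb X) := by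
      intro j
      have hy0 : (y : EuclideanSpace ℝ (Fin d)) ≠ 0 := by
        rw [← norm_pos_iff, norm_eq_of_mem_sphere]; exact one_pos
      have hx0 : (toAmb X j) ≠ 0 := by
        rw [← norm_pos_iff]
        exact (norm_eq_of_mem_sphere (X j)).symm ▸ one_pos
      exact ContinuousAt.comp (f := fun Z : Amb d n => ((y : EuclideanSpace ℝ (Fin d)), Z j))
        (continuousAt_angle (x := ((y : EuclideanSpace ℝ (Fin d)), toAmb X j)) hy0 hx0)
        (by fun_prop)
    have hev : ∀ᶠ Z : Amb d n in 𝓝 (toAmb X), ∀ j,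
        angle (y : EuclideanSpace ℝ (Fin d)) (Z i) ≤ angle (y : EuclideanSpace ℝ (Fin d)) (Z j) := by
      refine eventually_all.2 fun j => ?_
      by_cases hj : j = i
      · exact Eventually.of_forall fun Z => hj ▸ le_rfl
      · have hlt := h.lt hi hj
        rw [geoDist_eq_angle, geoDist_eq_angle] at hlt
        exact ((hc i).eventually_lt (hc j) hlt).mono fun Z hZ => hZ.le
    filter_upwards [hev] with Z hZ
    exact ciInf_half_sq_eq (fun j => angle_nonneg _ _) hZ

theorem integrable_extCost (hd : 2 ≤ d) (hn : 1 ≤ n) (X : Fin n → Sph d) :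
    Integrable (extCost (toAmb X)) (unif d) := by
  have := isProbabilityMeasure_unif hd
  refine Integrable.of_bound (measurable_extCost _).aestronglyMeasurable (1 / 2 * Real.pi ^ 2)
    (Eventually.of_forall fun y => ?_)
  obtain ⟨i, hi⟩ := exists_forall_geoDist_le hn X y
  rw [extCost_toAmb, ciInf_half_sq_eq (fun j => geoDist_nonneg _ _) hi, Real.norm_eq_abs,
    abs_of_nonneg (by positivity)]
  have := pow_le_pow_left₀ (geoDist_nonneg y (X i)) (geoDist_le_pi _ _) 2
  linarith

theorem lloyd_eq (X : Fin n → Sph d) : lloyd X = ∫ y, extCost (toAmb X) y ∂unif d := by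
  simp only [lloyd, extCost_toAmb]

theorem integral_innerSL {α E : Type*} [MeasurableSpace α] {μ : Measure α} [NormedAddCommGroup E]
    [InnerProductSpace ℝ E] [CompleteSpace E] {f : α → E} (hf : Integrable f μ) :
    ∫ a, innerSL ℝ (f a) ∂μ = innerSL ℝ (∫ a, f a ∂μ) :=
  (innerSL ℝ).integral_comp_comm hf

theorem hasGradientAt_integral_extCost (hd : 2 ≤ d) (hn : 1 ≤ n) {X : Fin n → Sph d}
    (hX : Function.Injective X) :
    HasGradientAt (fun Z => ∫ y, extCost Z y ∂unif d) (-meanQ X) (toAmb X) := by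
  have := isProbabilityMeasure_unif hd
  -- This form needs the Lipschitz bound only against the base point `toAmb X`, and
  -- differentiability of the integrand only there and for almost every `y`.
  have h := hasFDerivAt_integral_of_dominated_loc_of_lip' (μ := unif d) (𝕜 := ℝ)
    (F := fun Z y => extCost Z y) (F' := fun y => -innerSL ℝ (Q X y)) (x₀ := toAmb X)
    (s := Set.univ) (bound := fun _ => Real.pi * Real.pi) univ_mem
    (fun Z _ => (measurable_extCost Z).aestronglyMeasurable) (integrable_extCost hd hn X)
    ((innerSL ℝ).continuous.comp_aestronglyMeasurable
      (integrable_Q hd X).aestronglyMeasurable).neg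
    (Eventually.of_forall fun y Z _ => abs_extCost_sub_le hn Z X y) (integrable_const _)
    ((ae_generic hd hX).mono fun y hy => hasFDerivAt_extCost hn hy)
  refine h.2.congr_fderiv ?_
  rw [integral_neg, integral_innerSL (integrable_Q hd X), map_neg]
  rfl

theorem hasRiemGradAt_lloyd (hd : 2 ≤ d) (hn : 1 ≤ n) {X : Fin n → Sph d}
    (hX : Function.Injective X) : HasRiemGradAt lloyd (-meanQ X) X := by
  refine ⟨_, _, fun Z => (lloyd_eq Z).symm, hasGradientAt_integral_extCost hd hn hX, fun i => ?_⟩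
  rw [PiLp.neg_apply, inner_neg_right, inner_meanQ hd]
  simp

theorem hasSphGradAt_lloyd (hd : 2 ≤ d) (hn : 1 ≤ n) {X : Fin n → Sph d}
    (hX : Function.Injective X) (i : Fin n) :
    HasSphGradAt (fun x => lloyd (Function.update X i x)) (-meanQ X i) (X i) := by
  -- `T` inserts a vector into block `i`. The blockwise gradient is the chain rule along the affine
  -- map `z ↦ toAmb X + T (z - X i)`.
  set T : EuclideanSpace ℝ (Fin d) →L[ℝ] Amb d n :=
    ((PiLp.continuousLinearEquiv 2 ℝ fun _ : Fin n => EuclideanSpace ℝ (Fin d)).symm :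
      (Fin n → EuclideanSpace ℝ (Fin d)) →L[ℝ] Amb d n) ∘L
      ContinuousLinearMap.single ℝ (fun _ : Fin n => EuclideanSpace ℝ (Fin d)) i with hT
  have hTi : ∀ v, T v = PiLp.single 2 i v := fun v => rfl
  have hA : HasFDerivAt (fun z => toAmb X + T (z - X i)) T (X i : EuclideanSpace ℝ (Fin d)) := by
    have h1 := T.hasFDerivAt.comp (X i : EuclideanSpace ℝ (Fin d))
      ((hasFDerivAt_id (𝕜 := ℝ) (X i : EuclideanSpace ℝ (Fin d))).sub_const
        (X i : EuclideanSpace ℝ (Fin d)))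
    exact h1.const_add (toAmb X)
  have hG := hasGradientAt_integral_extCost hd hn hX
  have hX0 : toAmb X + T ((X i : EuclideanSpace ℝ (Fin d)) - X i) = toAmb X := by simp
  rw [← hX0] at hG
  refine ⟨_, -meanQ X i, fun z => ?_, (hG.hasFDerivAt.comp (X i : EuclideanSpace ℝ (Fin d)) hA).congr_fderiv ?_, ?_⟩
  · have hz : toAmb X + T ((z : EuclideanSpace ℝ (Fin d)) - X i) =
        toAmb (Function.update X i z) := by
      ext j : 1
      by_cases hj : j = i
      · subst hj
        simp [toAmb, hTi]
      · simp [toAmb, hTi, hj]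
    simp only [Function.comp_apply, hz, lloyd_eq]
  · ext v
    simp only [hTi, ContinuousLinearMap.comp_apply, InnerProductSpace.toDual_apply_apply]
    rw [PiLp.inner_apply, Finset.sum_eq_single i]
    · simp
    · intro j _ hj
      simp [hj]
    · simp
  · rw [inner_neg_right, inner_meanQ hd]
    simp

/-! ### Semiconcavity of the objective and continuity of its gradient. -/

theorem extCost_toAmb_le (X : Fin n → Sph d) (y : Sph d) (i : Fin n) :
    extCost (toAmb X) y ≤ 1 / 2 * geoDist y (X i) ^ 2 := by
  rw [extCost_toAmb]
  exact ciInf_le (Set.finite_range fun j => (1 / 2 : ℝ) * geoDist y (X j) ^ 2).bddBelow i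

theorem extCost_toAmb_eq {X : Fin n → Sph d} {y : Sph d} {i : Fin n}
    (hi : ∀ j, geoDist y (X i) ≤ geoDist y (X j)) :
    extCost (toAmb X) y = 1 / 2 * geoDist y (X i) ^ 2 := by
  rw [extCost_toAmb, ciInf_half_sq_eq (fun j => geoDist_nonneg _ _) hi]

/-- The Lloyd objective is semiconcave along the exponential map. -/
theorem lloyd_le_of_eq_expVec (hd : 2 ≤ d) (hn : 1 ≤ n) {X X' : Fin n → Sph d}
    (hX : Function.Injective X) {v : Amb d n}
    (hv : ∀ i, ⟪(X i : EuclideanSpace ℝ (Fin d)), v i⟫_ℝ = 0)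
    (hX' : ∀ i, (X' i : EuclideanSpace ℝ (Fin d)) = expVec (X i) (v i)) :
    lloyd X' ≤ lloyd X - ⟪meanQ X, v⟫_ℝ + 1 / 2 * ‖v‖ ^ 2 := by
  have := isProbabilityMeasure_unif hd
  have hi1 := integrable_extCost hd hn X
  have hi2 : Integrable (fun y => ⟪v, Q X y⟫_ℝ) (unif d) := (integrable_Q hd X).const_inner v
  have hle : lloyd X' ≤ ∫ y, (extCost (toAmb X) y - ⟪v, Q X y⟫_ℝ + 1 / 2 * ‖v‖ ^ 2) ∂unif d := by
    rw [lloyd_eq]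
    refine integral_mono_ae (integrable_extCost hd hn X') ((hi1.sub hi2).add
      (integrable_const _)) ?_
    filter_upwards [ae_generic hd hX] with y hy
    obtain ⟨i, hi⟩ := exists_forall_geoDist_le hn X y
    rw [real_inner_comm, hy.inner_Q hi, extCost_toAmb_eq hi]
    refine (extCost_toAmb_le X' y i).trans ?_
    have h1 := half_geoDist_sq_le (hy.1 i).2 (hv i) (hX' i)
    have h2 := pow_le_pow_left₀ (norm_nonneg _) (PiLp.norm_apply_le v i) 2
    linarith
  rw [integral_add (f := fun y => extCost (toAmb X) y - ⟪v, Q X y⟫_ℝ) (hi1.sub hi2)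
    (integrable_const _), integral_sub hi1 hi2, integral_inner (integrable_Q hd X),
    ← lloyd_eq, real_inner_comm] at hle
  simpa [meanQ] using hle

/-- The nearest center stays strictly nearest under small perturbations, so the cell indicators are
locally constant and only a logarithm varies. -/
theorem Generic.continuousAt_Q (hn : 1 ≤ n) {X : Fin n → Sph d} {y : Sph d} (h : Generic X y) :
    ContinuousAt (fun X => Q X y) X := by
  obtain ⟨i, hi⟩ := exists_forall_geoDist_le hn X y
  have hc : ∀ j, ContinuousAt (fun X : Fin n → Sph d => geoDist y (X j)) X := fun j =>
    (continuous_geoDist.comp (continuous_const.prodMk (continuous_apply j))).continuousAt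
  have hev : ∀ᶠ Z in 𝓝 X, ∀ j, j ≠ i → geoDist y (Z i) < geoDist y (Z j) := by
    refine eventually_all.2 fun j => ?_
    by_cases hj : j = i
    · exact Eventually.of_forall fun Z h => absurd hj h
    · exact ((hc i).eventually_lt (hc j) (h.lt hi hj)).mono fun Z hZ _ => hZ
  refine (PiLp.continuous_toLp 2 _).continuousAt.comp (continuousAt_pi.2 fun j => ?_)
  by_cases hj : j = i
  · subst hj
    have hlog : ContinuousAt (fun Z : Fin n → Sph d => logVec (Z j) y) X :=
      ContinuousAt.comp (f := fun Z : Fin n → Sph d => (Z j, y))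
        (continuousAt_logVec (x := X j) (h.1 j).1 (h.1 j).2)
        ((continuous_apply j).prodMk continuous_const).continuousAt
    refine hlog.congr ?_
    filter_upwards [hev] with Z hZ
    exact (if_pos fun k hk => (hZ k hk).le).symm
  · refine continuousAt_const (y := (0 : EuclideanSpace ℝ (Fin d))) |>.congr ?_
    filter_upwards [hev] with Z hZ
    exact (if_neg fun hy => (hZ j hj).not_ge (hy i (Ne.symm hj))).symm

theorem continuousAt_meanQ (hd : 2 ≤ d) (hn : 1 ≤ n) {X : Fin n → Sph d}
    (hX : Function.Injective X) : ContinuousAt (meanQ (d := d) (n := n)) X := by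
  have := isProbabilityMeasure_unif hd
  exact continuousAt_of_dominated (bound := fun _ => Real.pi * √(n : ℝ))
    (Eventually.of_forall fun Z => (measurable_Q_right Z).aestronglyMeasurable)
    (Eventually.of_forall fun Z => Eventually.of_forall fun y => norm_Q_le Z y)
    (integrable_const _) ((ae_generic hd hX).mono fun y hy => hy.continuousAt_Q hn)

/-! ### Collisions keep the gradient away from zero. -/

theorem le_inner_logVec {x y : Sph d} {v : EuclideanSpace ℝ (Fin d)}
    (hv : ⟪(x : EuclideanSpace ℝ (Fin d)), v⟫_ℝ = 0) (h1 : y ≠ x) (h2 : y ≠ -x)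
    (h0 : 0 ≤ ⟪(y : EuclideanSpace ℝ (Fin d)), v⟫_ℝ) :
    ⟪(y : EuclideanSpace ℝ (Fin d)), v⟫_ℝ ≤ ⟪logVec x y, v⟫_ℝ := by
  rw [inner_logVec_left hv]
  have hs := sin_geoDist_pos h1 h2
  have : 1 ≤ geoDist x y / Real.sin (geoDist x y) := by
    rw [one_le_div hs]
    exact Real.sin_le (geoDist_nonneg _ _)
  nlinarith

/-- If the centers with index in `C` are close to each other, while the set `U` is served by them
and lies on one side, then the gradient is large. -/
theorem le_norm_meanQ_of_cluster (hd : 2 ≤ d) (hn : 1 ≤ n) {X : Fin n → Sph d}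
    (hX : Function.Injective X) {C : Set (Fin n)} {i j : Fin n} (hi : i ∈ C) (hj : j ∈ C)
    (hij : i ≠ j) (hmax : ∀ l ∈ C, geoDist (X j) (X l) ≤ geoDist (X j) (X i))
    (hpi : geoDist (X j) (X i) < Real.pi) {U : Set (Sph d)} (hU : MeasurableSet U) {c : ℝ}
    (hc : 0 ≤ c) (hUC : ∀ y ∈ U, ∀ l, l ∉ C → geoDist y (X j) ≤ geoDist y (X l))
    (hUv : ∀ y ∈ U, c * geoDist (X j) (X i) ≤
      ⟪(y : EuclideanSpace ℝ (Fin d)), logVec (X j) (X i)⟫_ℝ) :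
    c * (unif d).real U ≤
      ‖meanQ X‖ * √(n : ℝ) + (n + 1) / 2 * geoDist (X j) (X i) := by
  classical
  have := isProbabilityMeasure_unif hd
  set ρ := geoDist (X j) (X i) with hρ
  have hρ0 : 0 < ρ := lt_of_le_of_ne (geoDist_nonneg _ _) fun h =>
    hij (hX (geoDist_eq_zero_iff.1 h.symm)).symm
  have hanti : ∀ l ∈ C, X l ≠ -X j := fun l hl h => by
    have := hmax l hl
    rw [geoDist_eq_pi_iff.2 h] at this
    linarith
  set X' : Fin n → Sph d := fun l => if l ∈ C then X j else X l with hX'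
  set v : Amb d n := WithLp.toLp 2 fun l => if l ∈ C then logVec (X l) (X j) else 0 with hv
  have hvl : ∀ l, v l = if l ∈ C then logVec (X l) (X j) else 0 := fun l => rfl
  have hvn : ‖v‖ ≤ ρ * √(n : ℝ) := by
    refine norm_le_of_forall_norm_le hρ0.le fun l => ?_
    rw [hvl]
    split_ifs with hl
    · exact (norm_logVec_le_geoDist _ _).trans ((geoDist_comm _ _).trans_le (hmax l hl))
    · simpa using hρ0.le
  -- Cost of merging the cluster into `X j`, by semiconcavity at `X`.
  have hup : lloyd X' ≤ lloyd X + ‖meanQ X‖ * (ρ * √(n : ℝ)) + 1 / 2 * (ρ ^ 2 * n) := by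
    have h1 := lloyd_le_of_eq_expVec hd hn hX (X' := X') (v := v) (fun l => by
      rw [hvl]
      split_ifs
      · exact inner_logVec _ _
      · exact inner_zero_right _) fun l => by
      rw [hvl]
      simp only [hX']
      split_ifs with hl
      · refine (expVec_logVec fun h => hanti l hl ?_).symm
        rw [h, neg_neg]
      · simp [expVec]
    have h2 := neg_le_of_abs_le (abs_real_inner_le_norm (meanQ X) v)
    have h3 := mul_le_mul_of_nonneg_left hvn (norm_nonneg (meanQ X))
    have h4 := pow_le_pow_left₀ (norm_nonneg _) hvn 2
    rw [mul_pow, Real.sq_sqrt (Nat.cast_nonneg _)] at h4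
    linarith
  -- Gain from splitting the merged point: points of `U`, served by `X j` in `X'`, may use `X i`
  -- instead. Elsewhere nothing is lost, since every center of `X'` is one of `X`.
  have hdown : lloyd X ≤ lloyd X' - c * ρ * (unif d).real U + 1 / 2 * ρ ^ 2 := by
    have hi1 := integrable_extCost hd hn X'
    have hi2 : Integrable (U.indicator fun _ => c * ρ) (unif d) :=
      (integrable_const _).indicator hU
    have hle : lloyd X ≤ ∫ y, (extCost (toAmb X') y - U.indicator (fun _ => c * ρ) y +
        1 / 2 * ρ ^ 2) ∂unif d := by
      rw [lloyd_eq]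
      refine integral_mono_ae (integrable_extCost hd hn X) ((hi1.sub hi2).add
        (integrable_const _)) ?_
      filter_upwards [ae_ne hd (X j), ae_ne hd (-X j)] with y hy1 hy2
      by_cases hy : y ∈ U
      · rw [Set.indicator_of_mem hy]
        have hmin : ∀ l, geoDist y (X' j) ≤ geoDist y (X' l) := by
          intro l
          simp only [hX', if_pos hj]
          split_ifs with hl
          · exact le_rfl
          · exact hUC y hy l hl
        rw [extCost_toAmb_eq hmin, show X' j = X j from if_pos hj]
        have h1 := extCost_toAmb_le X y i
        have h2 := half_geoDist_sq_le_logVec hy2 (hanti i hi)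
        have h3 := hUv y hy
        have h4 := le_inner_logVec (inner_logVec (X j) (X i)) hy1 hy2
          (le_trans (by positivity) h3)
        linarith
      · rw [Set.indicator_of_notMem hy]
        have : Nonempty (Fin n) := ⟨i⟩
        have h1 : extCost (toAmb X) y ≤ extCost (toAmb X') y := by
          rw [extCost_toAmb X']
          refine le_ciInf fun l => ?_
          by_cases hl : l ∈ C
          · simpa [hX', hl] using extCost_toAmb_le X y j
          · simpa [hX', hl] using extCost_toAmb_le X y l
        have : 0 ≤ ρ ^ 2 := by positivity
        linarith
    rw [integral_add (f := fun y => extCost (toAmb X') y - U.indicator (fun _ => c * ρ) y)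
      (hi1.sub hi2) (integrable_const _), integral_sub hi1 hi2, ← lloyd_eq,
      integral_indicator_const _ hU] at hle
    simp only [smul_eq_mul, integral_const, probReal_univ, one_mul] at hle
    linarith
  have hfin : ρ * (c * (unif d).real U) ≤
      ρ * (‖meanQ X‖ * √(n : ℝ) + (n + 1) / 2 * ρ) := by nlinarith
  exact le_of_mul_le_mul_left hfin hρ0

theorem exists_geoDist_eq {x : Sph d} {w : EuclideanSpace ℝ (Fin d)}
    (hw : ⟪(x : EuclideanSpace ℝ (Fin d)), w⟫_ℝ = 0) (hw1 : ‖w‖ = 1) {s : ℝ} (hs0 : 0 < s)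
    (hs : s < Real.pi) :
    ∃ y : Sph d, geoDist y x = s ∧ ⟪(y : EuclideanSpace ℝ (Fin d)), w⟫_ℝ = Real.sin s := by
  have hv : ⟪(x : EuclideanSpace ℝ (Fin d)), s • w⟫_ℝ = 0 := by rw [inner_smul_right, hw, mul_zero]
  have hn : ‖s • w‖ = s := by rw [norm_smul, hw1, mul_one, Real.norm_eq_abs, abs_of_pos hs0]
  have he : expVec x (s • w) = Real.cos s • (x : EuclideanSpace ℝ (Fin d)) + Real.sin s • w := by
    rw [expVec, hn, smul_smul, div_mul_cancel₀ _ hs0.ne']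
  refine ⟨⟨expVec x (s • w), by rw [mem_sphere_zero_iff_norm, norm_expVec x _ hv]⟩, ?_, ?_⟩
  · rw [geoDist]
    simp only [he]
    rw [inner_add_left, inner_smul_left, inner_smul_left, inner_self_sph, real_inner_comm, hw]
    simpa using Real.arccos_cos hs0.le hs.le
  · simp only [he]
    rw [inner_add_left, inner_smul_left, inner_smul_left, hw, real_inner_self_eq_norm_sq, hw1]
    simp

/-- Configurations with small gradient do not accumulate at a configuration with collisions. -/
theorem injective_of_tendsto_meanQ (hd : 2 ≤ d) (hn : 1 ≤ n) {X : ℕ → Fin n → Sph d}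
    {Z : Fin n → Sph d} (hX : ∀ k, Function.Injective (X k)) (hXZ : Tendsto X atTop (𝓝 Z))
    (hq : Tendsto (fun k => meanQ (X k)) atTop (𝓝 0)) : Function.Injective Z := by
  have := isProbabilityMeasure_unif hd
  intro i₀ j hZ
  by_contra hne
  set C : Set (Fin n) := {l | Z l = Z j} with hC
  have hCne : C.Nonempty := ⟨j, rfl⟩
  have hXl : ∀ l, Tendsto (fun k => X k l) atTop (𝓝 (Z l)) := fun l =>
    (continuous_apply l).continuousAt.tendsto.comp hXZ
  have hdist : ∀ a b, Tendsto (fun k => geoDist (X k a) (X k b)) atTop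
      (𝓝 (geoDist (Z a) (Z b))) := fun a b =>
    (hXl a).geoDist (hXl b)
  -- `i k` is the cluster member farthest from `X k j`. It sets the scale `ρ k`, and its direction
  -- subconverges to the unit vector `w`.
  choose i hiC hi using fun k =>
    Set.exists_max_image C (fun l => geoDist (X k j) (X k l)) C.toFinite hCne
  set ρ : ℕ → ℝ := fun k => geoDist (X k j) (X k (i k)) with hρ
  have hρ0 : ∀ k, 0 < ρ k := by
    intro k
    refine lt_of_lt_of_le (lt_of_le_of_ne (geoDist_nonneg _ _) fun h => ?_) (hi k i₀ hZ)
    exact hne (hX k (geoDist_eq_zero_iff.1 h.symm)).symm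
  have hρlim : Tendsto ρ atTop (𝓝 0) := by
    have hsum : Tendsto (fun k => ∑ l ∈ C.toFinite.toFinset, geoDist (X k j) (X k l)) atTop
        (𝓝 (∑ l ∈ C.toFinite.toFinset, geoDist (Z j) (Z l))) :=
      tendsto_finsetSum _ fun l _ => hdist j l
    rw [Finset.sum_eq_zero] at hsum
    · refine squeeze_zero (fun k => (hρ0 k).le) (fun k => ?_) hsum
      exact Finset.single_le_sum (f := fun l => geoDist (X k j) (X k l))
        (fun l _ => geoDist_nonneg _ _) (C.toFinite.mem_toFinset.2 (hiC k))
    · intro l hl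
      have : Z l = Z j := by simpa using hl
      rw [this, geoDist_self]
  set u : ℕ → EuclideanSpace ℝ (Fin d) := fun k => (ρ k)⁻¹ • logVec (X k j) (X k (i k)) with hu
  have hpi : ∀ᶠ k in atTop, ρ k < Real.pi := hρlim.eventually (gt_mem_nhds Real.pi_pos)
  have hus : ∀ k, u k ∈ Metric.closedBall (0 : EuclideanSpace ℝ (Fin d)) 1 := by
    intro k
    rw [mem_closedBall_zero_iff, hu, norm_smul, norm_inv, Real.norm_eq_abs, abs_of_pos (hρ0 k),
      inv_mul_le_one₀ (hρ0 k)]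
    exact norm_logVec_le_geoDist _ _
  obtain ⟨w, -, φ, hφ, hw⟩ := (isCompact_closedBall _ _).tendsto_subseq hus
  have hφt := hφ.tendsto_atTop
  have hw1 : ‖w‖ = 1 := by
    refine tendsto_nhds_unique hw.norm (tendsto_const_nhds.congr' ?_)
    filter_upwards [hφt.eventually hpi] with k hk
    have hanti : X (φ k) (i (φ k)) ≠ -X (φ k) j := fun h => by
      have h' := geoDist_eq_pi_iff.2 h
      exact hk.ne h'
    simp only [Function.comp_apply, hu]
    rw [norm_smul, norm_logVec hanti, norm_inv, Real.norm_eq_abs, abs_of_pos (hρ0 _),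
      inv_mul_cancel₀ (hρ0 _).ne']
  have hwx : ⟪(Z j : EuclideanSpace ℝ (Fin d)), w⟫_ℝ = 0 := by
    have h1 : Tendsto (fun k => ⟪(X (φ k) j : EuclideanSpace ℝ (Fin d)), u (φ k)⟫_ℝ) atTop
        (𝓝 ⟪(Z j : EuclideanSpace ℝ (Fin d)), w⟫_ℝ) :=
      (((continuous_subtype_val.tendsto _).comp ((hXl j).comp hφt))).inner hw
    refine tendsto_nhds_unique h1 (tendsto_const_nhds.congr fun k => ?_)
    rw [hu, inner_smul_right, inner_logVec, mul_zero]
  obtain ⟨m, hm, hm0⟩ : ∃ m : ℝ, (∀ l, l ∉ C → m < geoDist (Z j) (Z l)) ∧ 0 < m := by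
    have h1 : ∀ᶠ m : ℝ in 𝓝[>] 0, ∀ l, l ∉ C → m < geoDist (Z j) (Z l) := by
      refine eventually_all.2 fun l => ?_
      by_cases hl : l ∈ C
      · exact Eventually.of_forall fun _ h => absurd hl h
      · have hpos : 0 < geoDist (Z j) (Z l) := lt_of_le_of_ne (geoDist_nonneg _ _) fun h =>
          hl (geoDist_eq_zero_iff.1 h.symm).symm
        exact (eventually_nhdsWithin_of_eventually_nhds (gt_mem_nhds hpos)).mono fun _ h _ => h
    exact (h1.and self_mem_nhdsWithin).exists
  set s := min (m / 8) 1 with hs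
  have hs0 : 0 < s := lt_min (by linarith) one_pos
  have hspi : s < Real.pi := (min_le_right _ _).trans_lt (by linarith [Real.pi_gt_three])
  have hsm : s < m / 4 := (min_le_left _ _).trans_lt (by linarith)
  have hsin : 0 < Real.sin s := Real.sin_pos_of_pos_of_lt_pi hs0 hspi
  obtain ⟨y₀, hy₀, hy₀w⟩ := exists_geoDist_eq hwx hw1 hs0 hspi
  -- Closeness to `Z j` makes the cluster serve `U`. The side condition leaves a margin `sin s / 4`
  -- once `w` is replaced by a nearby direction `u (φ k)`. The set itself does not depend on `k`, so
  -- its mass is a fixed positive number.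
  set U : Set (Sph d) := {y | geoDist y (Z j) < m / 4} ∩
    {y | Real.sin s / 2 < ⟪(y : EuclideanSpace ℝ (Fin d)), w⟫_ℝ} with hU
  have hUo : IsOpen U := by
    refine (isOpen_lt ?_ continuous_const).inter (isOpen_lt continuous_const (by fun_prop))
    exact continuous_iff_continuousAt.2 fun y => tendsto_id.geoDist tendsto_const_nhds
  have hUpos : 0 < (unif d).real U :=
    ENNReal.toReal_pos (unif_pos_of_isOpen hUo ⟨y₀, by
      refine ⟨?_, ?_⟩
      · exact hy₀.trans_lt hsm
      · rw [Set.mem_ofPred_eq, hy₀w]; linarith⟩).ne' (measure_ne_top _ _)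
  have hclose : ∀ᶠ k in atTop, ∀ l, geoDist (X k l) (Z l) < m / 8 := by
    refine eventually_all.2 fun l => ?_
    have h1 : Tendsto (fun k => geoDist (X k l) (Z l)) atTop (𝓝 (geoDist (Z l) (Z l))) :=
      (hXl l).geoDist tendsto_const_nhds
    rw [geoDist_self] at h1
    exact h1.eventually (gt_mem_nhds (by linarith))
  have hwclose : ∀ᶠ k in atTop, ‖u (φ k) - w‖ < Real.sin s / 4 :=
    (tendsto_iff_norm_sub_tendsto_zero.1 hw).eventually (gt_mem_nhds (by linarith))
  have hbound : ∀ᶠ k in atTop, Real.sin s / 4 * (unif d).real U ≤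
      ‖meanQ (X (φ k))‖ * √(n : ℝ) + (n + 1) / 2 * ρ (φ k) := by
    filter_upwards [hφt.eventually hpi, hφt.eventually hclose, hwclose] with k hk1 hk2 hk3
    refine le_norm_meanQ_of_cluster hd hn (hX (φ k)) (hiC (φ k)) (rfl : j ∈ C)
      (fun h => ?_) (hi (φ k)) hk1 hUo.measurableSet (by positivity) ?_ ?_
    · have := hρ0 (φ k)
      simp [hρ, h] at this
    · intro y hy l hl
      have h1 : geoDist y (Z j) < m / 4 := hy.1
      have h2 := hm l hl
      have h3 := geoDist_triangle y (Z j) (X (φ k) j)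
      have h4 := geoDist_triangle (Z j) y (Z l)
      have h5 := geoDist_triangle y (X (φ k) l) (Z l)
      have h6 := hk2 j
      have h7 := hk2 l
      rw [geoDist_comm (Z j) (X (φ k) j)] at h3
      rw [geoDist_comm (Z j) y] at h4
      linarith
    · intro y hy
      have h1 : Real.sin s / 2 < ⟪(y : EuclideanSpace ℝ (Fin d)), w⟫_ℝ := hy.2
      have h2 := abs_real_inner_le_norm (y : EuclideanSpace ℝ (Fin d)) (u (φ k) - w)
      rw [norm_eq_of_mem_sphere, one_mul, inner_sub_right] at h2
      have h3 := neg_le_of_abs_le h2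
      have h4 : logVec (X (φ k) j) (X (φ k) (i (φ k))) = ρ (φ k) • u (φ k) := by
        simp only [hu]
        rw [smul_smul, mul_inv_cancel₀ (hρ0 _).ne', one_smul]
      rw [h4, inner_smul_right, mul_comm]
      exact mul_le_mul_of_nonneg_left (by linarith) (hρ0 _).le
  have hlim : Tendsto (fun k => ‖meanQ (X (φ k))‖ * √(n : ℝ) + (n + 1) / 2 * ρ (φ k)) atTop
      (𝓝 (‖(0 : Amb d n)‖ * √(n : ℝ) + (n + 1) / 2 * 0)) :=
    ((hq.comp hφt).norm.mul_const _).add ((hρlim.comp hφt).const_mul _)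
  -- In the limit the gradient and the cluster radius both vanish, whereas the lower bound is a
  -- positive constant.
  have hle := ge_of_tendsto hlim hbound
  rw [norm_zero] at hle
  have : 0 < Real.sin s / 4 * (unif d).real U := by positivity
  linarith

/-- Near configurations with small gradient, the gradient is small. -/
theorem exists_norm_meanQ_lt (hd : 2 ≤ d) (hn : 1 ≤ n) {ε : ℝ} (hε : 0 < ε) :
    ∃ δ > 0, ∀ X X' : Fin n → Sph d, Function.Injective X → Function.Injective X' →
      ‖meanQ X‖ ≤ δ → dist X X' ≤ δ → ‖meanQ X'‖ < ε := by
  by_contra! h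
  choose X X' hX hX' hq hdist hq' using fun k : ℕ => h (1 / ((k : ℝ) + 1)) (by positivity)
  obtain ⟨Z, -, φ, hφ, hZ⟩ := isCompact_univ.tendsto_subseq fun k => Set.mem_univ (X k)
  have hlim := tendsto_one_div_add_atTop_nhds_zero_nat (𝕜 := ℝ)
  have hq0 : Tendsto (fun k => meanQ (X k)) atTop (𝓝 0) := squeeze_zero_norm hq hlim
  have hZi := injective_of_tendsto_meanQ hd hn (fun k => hX (φ k)) hZ (hq0.comp hφ.tendsto_atTop)
  have hc := continuousAt_meanQ hd hn hZi
  have h0 : meanQ Z = 0 :=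
    tendsto_nhds_unique (hc.tendsto.comp hZ) (hq0.comp hφ.tendsto_atTop)
  have hd0 : Tendsto (fun k => dist (X k) (X' k)) atTop (𝓝 0) :=
    squeeze_zero (fun _ => dist_nonneg) hdist hlim
  have hZ' : Tendsto (X' ∘ φ) atTop (𝓝 Z) :=
    (tendsto_iff_of_dist (hd0.comp hφ.tendsto_atTop)).1 hZ
  have h1 := (hc.tendsto.comp hZ').norm
  rw [h0, norm_zero] at h1
  have := ge_of_tendsto h1 (Eventually.of_forall fun k => hq' (φ k))
  linarith

/-! ### Independence and convergence of martingale noise. -/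

section Independence

variable {Ω α β δ : Type*} {mΩ : MeasurableSpace Ω} [MeasurableSpace α] [MeasurableSpace β]
  [MeasurableSpace δ] {P : Measure Ω} [IsProbabilityMeasure P]

theorem indepFun_prodMk_of_indepFun_prodMk {A : Ω → α} {B : Ω → β} {C : Ω → δ} (hA : Measurable A)
    (hB : Measurable B) (hC : Measurable C) (h : IndepFun A (fun ω => (B ω, C ω)) P)
    (hBC : IndepFun B C P) : IndepFun (fun ω => (A ω, B ω)) C P := by
  have := Measure.isProbabilityMeasure_map (μ := P) hA.aemeasurable
  have := Measure.isProbabilityMeasure_map (μ := P) hB.aemeasurable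
  have := Measure.isProbabilityMeasure_map (μ := P) hC.aemeasurable
  have hAB : IndepFun A B P := h.comp measurable_id measurable_fst
  rw [indepFun_iff_map_prod_eq_prod_map_map (hA.prodMk hB).aemeasurable hC.aemeasurable,
    (indepFun_iff_map_prod_eq_prod_map_map hA.aemeasurable hB.aemeasurable).1 hAB]
  rw [indepFun_iff_map_prod_eq_prod_map_map hA.aemeasurable (hB.prodMk hC).aemeasurable,
    (indepFun_iff_map_prod_eq_prod_map_map hB.aemeasurable hC.aemeasurable).1 hBC,
    ← Measure.prodAssoc_prod] at h
  have h' := congrArg (Measure.map MeasurableEquiv.prodAssoc.symm) h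
  rw [Measure.map_map MeasurableEquiv.prodAssoc.symm.measurable
      MeasurableEquiv.prodAssoc.measurable, MeasurableEquiv.symm_comp_self, Measure.map_id,
    Measure.map_map MeasurableEquiv.prodAssoc.symm.measurable (hA.prodMk (hB.prodMk hC))] at h'
  exact h'

/-- Fubini for the product law. Integrability need not be assumed, as otherwise the integral is zero
by convention. -/
theorem integral_eq_zero_of_indepFun {V : Ω → α} {Y : Ω → β} {ν : Measure β} (hV : Measurable V)
    (hY : Measurable Y) (hind : IndepFun V Y P) (hlaw : P.map Y = ν) {F : α × β → ℝ}
    (hF : Measurable F) (h0 : ∀ v, ∫ y, F (v, y) ∂ν = 0) : ∫ ω, F (V ω, Y ω) ∂P = 0 := by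
  have := Measure.isProbabilityMeasure_map (μ := P) hV.aemeasurable
  have := Measure.isProbabilityMeasure_map (μ := P) hY.aemeasurable
  by_cases hi : Integrable (fun ω => F (V ω, Y ω)) P
  · have hm := (indepFun_iff_map_prod_eq_prod_map_map hV.aemeasurable hY.aemeasurable).1 hind
    have hi' := (integrable_map_measure hF.aestronglyMeasurable (hV.prodMk hY).aemeasurable).2 hi
    rw [hm] at hi'
    have h1 := integral_map (hV.prodMk hY).aemeasurable (μ := P) (f := F) hF.aestronglyMeasurable
    rw [← h1, hm, integral_prod _ hi', hlaw]
    simp [h0]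
  · exact integral_undef hi

/-- A series of bounded centered terms `h (V t) (Y t)`, where `Y t` is independent of the past,
with square summable weights, converges almost surely. -/
theorem ae_tendsto_sum_of_indep (ℱ : Filtration ℕ mΩ) {V : ℕ → Ω → α} {Y : ℕ → Ω → β}
    {ν : Measure β} (hV : ∀ t, Measurable[ℱ t] (V t)) (hY : ∀ t, Measurable[ℱ (t + 1)] (Y t))
    (hind : ∀ t, Indep (ℱ t) (MeasurableSpace.comap (Y t) inferInstance) P)
    (hlaw : ∀ t, P.map (Y t) = ν) {γ : ℕ → ℝ} (hγ : Summable fun t => γ t ^ 2) {h : α × β → ℝ}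
    (hh : Measurable h) {C : ℝ} (hC : ∀ p, |h p| ≤ C) (h0 : ∀ v, ∫ y, h (v, y) ∂ν = 0) :
    ∀ᵐ ω ∂P, ∃ l, Tendsto (fun T => ∑ t ∈ Finset.range T, γ t * h (V t ω, Y t ω)) atTop (𝓝 l) := by
  set M : ℕ → Ω → ℝ := fun T ω => ∑ t ∈ Finset.range T, γ t * h (V t ω, Y t ω) with hM
  have hV' : ∀ t, Measurable (V t) := fun t => (hV t).mono (ℱ.le t) le_rfl
  have hY' : ∀ t, Measurable (Y t) := fun t => (hY t).mono (ℱ.le _) le_rfl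
  have hMsucc : ∀ T ω, M (T + 1) ω = M T ω + γ T * h (V T ω, Y T ω) := fun T ω =>
    Finset.sum_range_succ _ _
  have hMm : ∀ T, Measurable[ℱ T] (M T) := by
    intro T
    refine Finset.measurable_fun_sum _ fun t ht => Measurable.const_mul ?_ _
    have ht' := Finset.mem_range.1 ht
    have h1 : Measurable[ℱ T] (V t) := (hV t).mono (ℱ.mono ht'.le) le_rfl
    have h2 : Measurable[ℱ T] (Y t) := (hY t).mono (ℱ.mono ht') le_rfl
    exact hh.comp (h1.prodMk h2)
  have hMm' : ∀ T, Measurable (M T) := fun T => (hMm T).mono (ℱ.le T) le_rfl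
  have hMb : ∀ T, ∃ K, ∀ ω, |M T ω| ≤ K := by
    intro T
    refine ⟨∑ t ∈ Finset.range T, |γ t| * C, fun ω => ?_⟩
    refine (Finset.abs_sum_le_sum_abs _ _).trans (Finset.sum_le_sum fun t _ => ?_)
    rw [abs_mul]
    exact mul_le_mul_of_nonneg_left (hC _) (abs_nonneg _)
  have hbi : ∀ {f : Ω → ℝ}, Measurable f → (∃ K, ∀ ω, |f ω| ≤ K) → Integrable f P := by
    rintro f hf ⟨K, hK⟩
    exact Integrable.of_bound hf.aestronglyMeasurable K (Eventually.of_forall hK)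
  have hMi : ∀ T, Integrable (M T) P := fun T => hbi (hMm' T) (hMb T)
  have hhm : ∀ T, Measurable fun ω => h (V T ω, Y T ω) := fun T =>
    hh.comp ((hV' T).prodMk (hY' T))
  have hhi : ∀ T, Integrable (fun ω => h (V T ω, Y T ω)) P := fun T =>
    hbi (hhm T) ⟨C, fun ω => hC _⟩
  -- Used twice: indicators `A` give the martingale property, and `A = M T` removes the cross term
  -- in the second moment.
  have hzero : ∀ T (A : Ω → ℝ), Measurable[ℱ T] A → ∫ ω, A ω * h (V T ω, Y T ω) ∂P = 0 := by
    intro T A hA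
    have hAV : Measurable[ℱ T] fun ω => (A ω, V T ω) := hA.prodMk (hV T)
    have hA' : Measurable A := hA.mono (ℱ.le T) le_rfl
    have hi : IndepFun (fun ω => (A ω, V T ω)) (Y T) P :=
      (IndepFun_iff_Indep _ _ _).2 (indep_of_indep_of_le_left (hind T) hAV.comap_le)
    have hF : Measurable fun p : (ℝ × α) × β => p.1.1 * h (p.1.2, p.2) :=
      (measurable_fst.comp measurable_fst).mul
        (hh.comp ((measurable_snd.comp measurable_fst).prodMk measurable_snd))
    refine integral_eq_zero_of_indepFun (hA'.prodMk (hV' T)) (hY' T) hi (hlaw T) hF fun v => ?_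
    simp only
    rw [integral_const_mul, h0, mul_zero]
  have hsub : Submartingale M ℱ P := by
    refine submartingale_of_setIntegral_le_succ (fun T => (hMm T).stronglyMeasurable) hMi
      fun T s hs => le_of_eq ?_
    have hz := hzero T (s.indicator fun _ => 1) (measurable_const.indicator hs)
    have hz' : ∫ ω in s, h (V T ω, Y T ω) ∂P = 0 := by
      rw [← integral_indicator (ℱ.le T s hs), ← hz]
      congr 1 with ω
      by_cases hω : ω ∈ s <;> simp [hω]
    simp only [hMsucc]
    rw [integral_add (hMi T).integrableOn ((hhi T).const_mul _).integrableOn, integral_const_mul,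
      hz', mul_zero, add_zero]
  have hL2 : ∀ T, ∫ ω, M T ω ^ 2 ∂P ≤ ∑ t ∈ Finset.range T, C ^ 2 * γ t ^ 2 := by
    intro T
    induction T with
    | zero => simp [hM]
    | succ T ih =>
      obtain ⟨K, hK⟩ := hMb T
      have hi1 : Integrable (fun ω => M T ω ^ 2) P :=
        hbi ((hMm' T).pow_const 2) ⟨K ^ 2, fun ω => by
          rw [abs_pow]; exact pow_le_pow_left₀ (abs_nonneg _) (hK ω) 2⟩
      have hi2 : Integrable (fun ω => M T ω * h (V T ω, Y T ω)) P :=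
        hbi ((hMm' T).mul (hhm T)) ⟨K * C, fun ω => by
          rw [abs_mul]
          exact mul_le_mul (hK ω) (hC _) (abs_nonneg _) ((abs_nonneg _).trans (hK ω))⟩
      have hle : ∫ ω, M (T + 1) ω ^ 2 ∂P ≤
          ∫ ω, (M T ω ^ 2 + 2 * γ T * (M T ω * h (V T ω, Y T ω)) + C ^ 2 * γ T ^ 2) ∂P := by
        obtain ⟨K', hK'⟩ := hMb (T + 1)
        refine integral_mono (hbi ((hMm' (T + 1)).pow_const 2) ⟨K' ^ 2, fun ω => by
          rw [abs_pow]; exact pow_le_pow_left₀ (abs_nonneg _) (hK' ω) 2⟩)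
          ((hi1.add (hi2.const_mul _)).add (integrable_const _)) fun ω => ?_
        have h1 := pow_le_pow_left₀ (abs_nonneg _) (hC (V T ω, Y T ω)) 2
        rw [sq_abs] at h1
        have h2 := mul_le_mul_of_nonneg_left h1 (sq_nonneg (γ T))
        simp only [hMsucc]
        nlinarith
      rw [integral_add (f := fun ω => M T ω ^ 2 + 2 * γ T * (M T ω * h (V T ω, Y T ω)))
        (hi1.add (hi2.const_mul _)) (integrable_const _), integral_add hi1 (hi2.const_mul _),
        integral_const_mul, hzero T _ (hMm T)] at hle
      simp only [integral_const, probReal_univ, one_smul, mul_zero, add_zero] at hle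
      rw [Finset.sum_range_succ]
      linarith
  set S := ∑' t, C ^ 2 * γ t ^ 2 with hS
  have hL2' : ∀ T, ∫ ω, M T ω ^ 2 ∂P ≤ S := fun T => (hL2 T).trans
    ((hγ.mul_left _).sum_le_tsum _ fun t _ => by positivity)
  -- The `L¹` bound follows from the second moments through `|M| ≤ 1 + M ^ 2`.
  refine hsub.exists_ae_tendsto_of_bdd (R := (1 + S).toNNReal) fun T => ?_
  rw [eLpNorm_one_eq_lintegral_enorm, ← ofReal_integral_norm_eq_lintegral_enorm (hMi T)]
  refine ENNReal.ofReal_le_ofReal ?_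
  obtain ⟨K, hK⟩ := hMb T
  have hi1 : Integrable (fun ω => M T ω ^ 2) P :=
    hbi ((hMm' T).pow_const 2) ⟨K ^ 2, fun ω => by
      rw [abs_pow]; exact pow_le_pow_left₀ (abs_nonneg _) (hK ω) 2⟩
  have hle : ∫ ω, ‖M T ω‖ ∂P ≤ ∫ ω, (1 + M T ω ^ 2) ∂P := by
    refine integral_mono (hMi T).norm ((integrable_const _).add hi1) fun ω => ?_
    simp only [Real.norm_eq_abs]
    nlinarith [sq_abs (M T ω), sq_nonneg (|M T ω| - 1), abs_nonneg (M T ω)]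
  rw [integral_add (integrable_const _) hi1] at hle
  simp only [integral_const, probReal_univ, one_smul] at hle
  linarith [hL2' T]

end Independence

/-! ### Deterministic recursions. -/

/-- Subtracting the partial sums of `m` makes `a` antitone and bounded below. The terms `m t` may
have any sign: only convergence of their sums matters, which is what the martingale noise offers. -/
theorem exists_tendsto_and_summable_of_le {a b m : ℕ → ℝ} (ha : ∀ t, 0 ≤ a t) (hb : ∀ t, 0 ≤ b t)
    (hle : ∀ t, a (t + 1) ≤ a t - b t + m t) {l : ℝ}
    (hm : Tendsto (fun T => ∑ t ∈ Finset.range T, m t) atTop (𝓝 l)) :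
    (∃ L, Tendsto a atTop (𝓝 L)) ∧ Summable b := by
  obtain ⟨B, hB⟩ := hm.bddAbove_range
  have hB' : ∀ T, ∑ t ∈ Finset.range T, m t ≤ B := fun T => hB ⟨T, rfl⟩
  constructor
  · have hanti : Antitone fun T => a T - ∑ t ∈ Finset.range T, m t := by
      refine antitone_nat_of_succ_le fun T => ?_
      rw [Finset.sum_range_succ]
      linarith [hle T, hb T]
    have hbdd : BddBelow (Set.range fun T => a T - ∑ t ∈ Finset.range T, m t) := by
      refine ⟨-B, ?_⟩
      rintro _ ⟨T, rfl⟩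
      simp only
      linarith [hB' T, ha T]
    have h := (tendsto_atTop_ciInf hanti hbdd).add hm
    simp only [sub_add_cancel] at h
    exact ⟨_, h⟩
  · refine summable_of_sum_range_le (c := a 0 + B) hb fun T => ?_
    have h : ∀ T, ∑ t ∈ Finset.range T, b t ≤ a 0 - a T + ∑ t ∈ Finset.range T, m t := by
      intro T
      induction T with
      | zero => simp
      | succ T ih =>
        rw [Finset.sum_range_succ, Finset.sum_range_succ]
        linarith [hle T]
    linarith [h T, hB' T, ha T]

/-- Perturbed gradient iterations have vanishing gradients, provided that the gradient is small
near points at which it is small enough. -/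
theorem tendsto_zero_of_perturbed_gradient {E : Type*} [NormedAddCommGroup E] [NormedSpace ℝ E]
    {Z q e : ℕ → E} {γ : ℕ → ℝ} {B : ℝ} {l : E} (hγ : ∀ t, 0 ≤ γ t)
    (hγ0 : Tendsto γ atTop (𝓝 0))
    (hγs : Tendsto (fun T => ∑ t ∈ Finset.range T, γ t) atTop atTop) (hqB : ∀ t, ‖q t‖ ≤ B)
    (hZ : ∀ t, Z (t + 1) = Z t + γ t • q t + e t)
    (he : Tendsto (fun T => ∑ t ∈ Finset.range T, e t) atTop (𝓝 l))
    (hsum : Summable fun t => γ t * ‖q t‖ ^ 2)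
    (hq : ∀ ε > 0, ∃ δ > 0, ∀ s t, ‖q s‖ ≤ δ → dist (Z s) (Z t) ≤ δ → ‖q t‖ < ε) :
    Tendsto q atTop (𝓝 0) := by
  rw [Metric.tendsto_atTop]
  intro ε hε
  obtain ⟨δ, hδ, hqδ⟩ := hq ε hε
  set S := fun T => ∑ t ∈ Finset.range T, e t with hS
  set R := fun T => ∑ t ∈ Finset.range T, γ t * ‖q t‖ ^ 2 with hR
  obtain ⟨T₁, hT₁⟩ := Metric.cauchySeq_iff.1 he.cauchySeq (δ / 4) (by positivity)
  obtain ⟨T₂, hT₂⟩ := Metric.cauchySeq_iff.1 hsum.hasSum.tendsto_sum_nat.cauchySeq (δ ^ 2 / 4)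
    (by positivity)
  have hγB : Tendsto (fun t => γ t * B) atTop (𝓝 (0 * B)) := hγ0.mul_const B
  rw [zero_mul] at hγB
  obtain ⟨T₃, hT₃⟩ := eventually_atTop.1 (hγB.eventually (gt_mem_nhds (show 0 < δ / 4 by positivity)))
  set T := max T₁ (max T₂ T₃) with hT
  have hT1 : T₁ ≤ T := le_max_left _ _
  have hT2 : T₂ ≤ T := (le_max_left _ _).trans (le_max_right _ _)
  have hT3 : T₃ ≤ T := (le_max_right _ _).trans (le_max_right _ _)
  -- Otherwise `γ t ≤ δ⁻² γ t ‖q t‖ ^ 2` from `T` on, which would make `γ` summable.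
  obtain ⟨s₀, hs₀, hqs₀⟩ : ∃ s ≥ T, ‖q s‖ ≤ δ := by
    by_contra! hcon
    have h1 : Summable fun t => γ (t + T) := by
      refine Summable.of_nonneg_of_le (fun t => hγ _) (fun t => ?_)
        (((summable_nat_add_iff T).2 hsum).mul_left (δ ^ 2)⁻¹)
      have h2 := pow_le_pow_left₀ hδ.le (hcon (t + T) (by omega)).le 2
      rw [inv_mul_eq_div, le_div_iff₀ (by positivity)]
      exact mul_le_mul_of_nonneg_left h2 (hγ _)
    exact not_tendsto_nhds_of_tendsto_atTop hγs _
      ((summable_nat_add_iff T).1 h1).hasSum.tendsto_sum_nat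
  -- `s` is the last time up to `t` with `‖q s‖ ≤ δ`. The step leaving `s` is bounded by `γ s * B`.
  -- Later steps have `‖q‖ > δ`, hence `γ ‖q‖ ≤ γ ‖q‖ ^ 2 / δ`, which telescopes in `R`.
  have hinv : ∀ t ≥ s₀, ∃ s, T ≤ s ∧ s ≤ t ∧ ‖q s‖ ≤ δ ∧ (t = s ∨ (δ < ‖q t‖ ∧
      ‖Z t - Z s - (S t - S s)‖ ≤ γ s * B + (R t - R s) / δ)) := by
    intro t ht
    induction t, ht using Nat.le_induction with
    | base => exact ⟨s₀, hs₀, le_rfl, hqs₀, Or.inl rfl⟩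
    | succ t ht ih =>
      by_cases hqt : ‖q (t + 1)‖ ≤ δ
      · exact ⟨t + 1, by omega, le_rfl, hqt, Or.inl rfl⟩
      · obtain ⟨s, hTs, hst, hqs, h⟩ := ih
        refine ⟨s, hTs, by omega, hqs, Or.inr ⟨not_le.1 hqt, ?_⟩⟩
        have hSt : S (t + 1) = S t + e t := Finset.sum_range_succ _ _
        have hRt : R (t + 1) = R t + γ t * ‖q t‖ ^ 2 := Finset.sum_range_succ _ _
        have heq : Z (t + 1) - Z s - (S (t + 1) - S s) =
            (Z t - Z s - (S t - S s)) + γ t • q t := by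
          rw [hZ, hSt]; abel
        rw [heq, hRt]
        have hn : ‖γ t • q t‖ = γ t * ‖q t‖ := by
          rw [norm_smul, Real.norm_eq_abs, abs_of_nonneg (hγ t)]
        rcases h with rfl | ⟨hδt, h⟩
        · rw [sub_self, sub_self, sub_self, zero_add, hn, add_sub_cancel_left]
          have h1 := mul_le_mul_of_nonneg_left (hqB t) (hγ t)
          have h2 : 0 ≤ γ t * ‖q t‖ ^ 2 / δ := by have := hγ t; positivity
          linarith
        · refine (norm_add_le _ _).trans ?_
          rw [hn]
          have h1 : γ t * ‖q t‖ ≤ γ t * ‖q t‖ ^ 2 / δ := by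
            rw [le_div_iff₀ hδ, mul_assoc]
            refine mul_le_mul_of_nonneg_left ?_ (hγ t)
            nlinarith [norm_nonneg (q t)]
          have h2 : (R t + γ t * ‖q t‖ ^ 2 - R s) / δ =
              (R t - R s) / δ + γ t * ‖q t‖ ^ 2 / δ := by ring
          linarith
  refine ⟨s₀, fun t ht => ?_⟩
  rw [dist_zero_right]
  obtain ⟨s, hTs, hst, hqs, h⟩ := hinv t ht
  refine hqδ s t hqs ?_
  rcases h with rfl | ⟨-, h⟩
  · rw [dist_self]; exact hδ.le
  · have h1 := hT₁ t (by omega) s (by omega)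
    have h2 := hT₂ t (by omega) s (by omega)
    have h3 := hT₃ s (by omega)
    rw [dist_eq_norm] at h1
    rw [Real.dist_eq] at h2
    have h4 := (le_abs_self _).trans h2.le
    have h5 : (R t - R s) / δ ≤ δ / 4 := by
      rw [div_le_iff₀ hδ]
      calc R t - R s ≤ δ ^ 2 / 4 := h4
        _ = δ / 4 * δ := by ring
    rw [dist_comm, dist_eq_norm]
    have h6 : ‖Z t - Z s‖ ≤ ‖Z t - Z s - (S t - S s)‖ + ‖S t - S s‖ := by
      simpa using norm_add_le (Z t - Z s - (S t - S s)) (S t - S s)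
    linarith

/-! ### One step of the iteration: measurability and absence of collisions. -/

theorem coe_step (c : ℝ) (y : Sph d) (X : Fin n → Sph d) (i : Fin n) :
    (step c y X i : EuclideanSpace ℝ (Fin d)) = expVec (X i) (c • Qi X y i) := by
  simp [step]

theorem _root_.Measurable.lloydStep {α : Type*} [MeasurableSpace α] {f : α → Fin n → Sph d}
    {g : α → Sph d} (c : ℝ) (hf : Measurable f) (hg : Measurable g) :
    Measurable fun a => step c (g a) (f a) := by
  refine measurable_pi_lambda _ fun i => Measurable.subtype_mk ?_
  have hv : Measurable fun a => -c • (-Qi (f a) (g a) i) := ((hf.Qi hg i).neg).const_smul (-c)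
  have hx : Measurable fun a => (f a i : EuclideanSpace ℝ (Fin d)) :=
    ((measurable_pi_apply i).comp hf).subtype_val
  exact ((Real.measurable_cos.comp hv.norm).smul hx).add
    (((Real.measurable_sin.comp hv.norm).div hv.norm).smul hv)

theorem countable_setOf_cos_eq (c : ℝ) : {t : ℝ | Real.cos t = c}.Countable := by
  rcases Set.eq_empty_or_nonempty {t : ℝ | Real.cos t = c} with h | ⟨s, hs⟩
  · rw [h]; exact Set.countable_empty
  · refine ((Set.countable_range fun k : ℤ => 2 * k * Real.pi + s).union
      (Set.countable_range fun k : ℤ => 2 * k * Real.pi - s)).mono fun t ht => ?_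
    obtain ⟨k, hk⟩ := Real.cos_eq_cos_iff.1 (show Real.cos s = Real.cos t from hs.trans ht.symm)
    rcases hk with hk | hk
    · exact Or.inl ⟨k, hk.symm⟩
    · exact Or.inr ⟨k, hk.symm⟩

/-- Almost surely, a step of stochastic gradient descent does not create collisions. -/
theorem ae_injective_step (hd : 2 ≤ d) (hn : 1 ≤ n) {X : Fin n → Sph d}
    (hX : Function.Injective X) (c : ℝ) : ∀ᵐ y ∂unif d, Function.Injective (step c y X) := by
  rcases eq_or_ne c 0 with rfl | hc
  · refine Eventually.of_forall fun y => ?_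
    have : step 0 y X = X := by
      ext1 i
      apply Subtype.ext
      rw [coe_step]
      simp [expVec]
    rwa [this]
  -- For generic `y` only the nearest center `X i` moves, by `c * θ` along the geodesic to `y` at
  -- distance `θ`. Landing on `X j` forces `cos (c * θ) = ⟪X i, X j⟫`, so `⟪X i, y⟫ = cos θ` lies in
  -- a countable set. Each of its values has probability zero.
  have hcount : ∀ i j, (Real.cos '' {θ | Real.cos (c * θ) =
      ⟪(X i : EuclideanSpace ℝ (Fin d)), X j⟫_ℝ}).Countable := fun i j =>
    ((countable_setOf_cos_eq _).preimage (mul_right_injective₀ hc)).image _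
  have hae : ∀ᵐ y : Sph d ∂unif d, ∀ i j, ∀ u ∈ Real.cos '' {θ | Real.cos (c * θ) =
      ⟪(X i : EuclideanSpace ℝ (Fin d)), X j⟫_ℝ},
      ⟪(X i : EuclideanSpace ℝ (Fin d)), y⟫_ℝ ≠ u :=
    ae_all_iff.2 fun i => ae_all_iff.2 fun j =>
      (ae_ball_iff (hcount i j)).2 fun u _ => ae_inner_ne hd (X i) u
  filter_upwards [hae, ae_generic hd hX] with y hy hgen
  obtain ⟨i, hi⟩ := exists_forall_geoDist_le hn X y
  have hstay : ∀ j, j ≠ i → step c y X j = X j := fun j hj => by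
    apply Subtype.ext
    rw [coe_step, hgen.Qi_eq_zero hi hj]
    simp [expVec]
  have hmove : ∀ j, step c y X i ≠ X j := by
    intro j h
    have h1 : ⟪(X i : EuclideanSpace ℝ (Fin d)), step c y X i⟫_ℝ =
        ⟪(X i : EuclideanSpace ℝ (Fin d)), X j⟫_ℝ := by rw [h]
    rw [coe_step, Qi_eq_logVec hi, expVec, inner_add_right, inner_smul_right, inner_smul_right,
      inner_smul_right, inner_logVec, inner_self_sph, norm_smul, norm_logVec (hgen.1 i).2,
      mul_zero, mul_zero, add_zero, mul_one, ← abs_of_nonneg (geoDist_nonneg (X i) y),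
      Real.norm_eq_abs, ← abs_mul, Real.cos_abs] at h1
    exact hy i j _ ⟨_, h1, rfl⟩ (cos_geoDist _ _).symm
  intro a b hab
  by_cases ha : a = i <;> by_cases hb : b = i
  · rw [ha, hb]
  · rw [ha, hstay b hb] at hab
    exact absurd hab (hmove b)
  · rw [hb, hstay a ha] at hab
    exact absurd hab.symm (hmove a)
  · rw [hstay a ha, hstay b hb] at hab
    exact hX hab

theorem measurable_meanQ (hd : 2 ≤ d) : Measurable (meanQ (d := d) (n := n)) := by
  have := isProbabilityMeasure_unif hd
  have h : Measurable fun p : (Fin n → Sph d) × Sph d => Q p.1 p.2 :=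
    measurable_fst.lloydQ measurable_snd
  exact h.stronglyMeasurable.integral_prod_right'.measurable

theorem integral_inner_Q_sub_meanQ (hd : 2 ≤ d) (X : Fin n → Sph d) (c : Amb d n) :
    ∫ y, ⟪c, Q X y - meanQ X⟫_ℝ ∂unif d = 0 := by
  have := isProbabilityMeasure_unif hd
  rw [integral_inner (f := fun y => Q X y - meanQ X)
      ((integrable_Q hd X).sub (integrable_const _)),
    integral_sub (integrable_Q hd X) (integrable_const _), integral_const, probReal_univ, one_smul,
    meanQ, sub_self, inner_zero_right]

/-! ### Filtration of the iterates and almost sure distinctness. -/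

section SGD

variable {Ω : Type*} {mΩ : MeasurableSpace Ω}

/-- The initial configuration and the samples before time `t`. -/
def past (Y : ℕ → Ω → Sph d) (X₀ : Ω → Fin n → Sph d) (t : ℕ) (ω : Ω) :
    (Fin n → Sph d) × (Finset.range t → Sph d) :=
  (X₀ ω, fun s => Y s ω)

theorem measurable_past {Y : ℕ → Ω → Sph d} {X₀ : Ω → Fin n → Sph d}
    (hY : ∀ t, Measurable (Y t)) (hX₀ : Measurable X₀) (t : ℕ) : Measurable (past Y X₀ t) :=
  hX₀.prodMk (measurable_pi_lambda _ fun s => hY s)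

/-- The filtration generated by the initial configuration and the samples. -/
def pastFiltration {Y : ℕ → Ω → Sph d} {X₀ : Ω → Fin n → Sph d}
    (hY : ∀ t, Measurable (Y t)) (hX₀ : Measurable X₀) : Filtration ℕ mΩ where
  seq t := MeasurableSpace.comap (past Y X₀ t) inferInstance
  mono' := by
    intro s t hst
    have hg : Measurable fun p : (Fin n → Sph d) × (Finset.range t → Sph d) =>
        (p.1, fun r : Finset.range s => p.2 ⟨r, Finset.range_mono hst r.2⟩) :=
      measurable_fst.prodMk
        (measurable_pi_lambda _ fun r => (measurable_pi_apply _).comp measurable_snd)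
    exact (hg.comp (comap_measurable (past Y X₀ t))).comap_le
  le' t := (measurable_past hY hX₀ t).comap_le

theorem measurable_sample_pastFiltration {Y : ℕ → Ω → Sph d} {X₀ : Ω → Fin n → Sph d}
    (hY : ∀ t, Measurable (Y t)) (hX₀ : Measurable X₀) (t : ℕ) :
    Measurable[pastFiltration hY hX₀ (t + 1)] (Y t) := by
  have hg : Measurable fun p : (Fin n → Sph d) × (Finset.range (t + 1) → Sph d) =>
      p.2 ⟨t, Finset.self_mem_range_succ t⟩ := (measurable_pi_apply _).comp measurable_snd
  exact hg.comp (comap_measurable (past Y X₀ (t + 1)))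

theorem measurable_sgd_pastFiltration {Y : ℕ → Ω → Sph d} {X₀ : Ω → Fin n → Sph d}
    (hY : ∀ t, Measurable (Y t)) (hX₀ : Measurable X₀) (γ : ℕ → ℝ) (t : ℕ) :
    Measurable[pastFiltration hY hX₀ t] fun ω => sgd γ (fun s => Y s ω) (X₀ ω) t := by
  induction t with
  | zero => exact measurable_fst.comp (comap_measurable (past Y X₀ 0))
  | succ t ih =>
    have h1 := ih.mono ((pastFiltration hY hX₀).mono t.le_succ) le_rfl
    exact @Measurable.lloydStep d n Ω (pastFiltration hY hX₀ (t + 1)) _ _ (γ t) h1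
      (measurable_sample_pastFiltration hY hX₀ t)

variable {P : Measure Ω} [IsProbabilityMeasure P]

theorem indep_pastFiltration {Y : ℕ → Ω → Sph d} {X₀ : Ω → Fin n → Sph d}
    (hY : ∀ t, Measurable (Y t)) (hX₀ : Measurable X₀) (hYi : iIndepFun Y P)
    (hXY : IndepFun X₀ (fun ω t => Y t ω) P) (t : ℕ) :
    Indep (pastFiltration hY hX₀ t) (MeasurableSpace.comap (Y t) inferInstance) P := by
  have h1 : IndepFun (fun ω (s : Finset.range t) => Y s ω) (Y t) P := by
    have h := hYi.indepFun_finset (Finset.range t) {t} (by simp) hY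
    exact h.comp measurable_id (measurable_pi_apply (⟨t, Finset.mem_singleton_self t⟩ :
      ({t} : Finset ℕ)))
  have h2 : IndepFun X₀ (fun ω => ((fun s : Finset.range t => Y s ω), Y t ω)) P := by
    have hg : Measurable fun y : ℕ → Sph d => ((fun s : Finset.range t => y s), y t) :=
      (measurable_pi_lambda _ fun s => measurable_pi_apply _).prodMk (measurable_pi_apply t)
    exact hXY.comp measurable_id hg
  exact (IndepFun_iff_Indep _ _ _).1 (indepFun_prodMk_of_indepFun_prodMk hX₀
    (measurable_pi_lambda _ fun s => hY s) (hY t) h2 h1)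

theorem ae_injective_sgd (hd : 2 ≤ d) (hn : 1 ≤ n) {Y : ℕ → Ω → Sph d} {X₀ : Ω → Fin n → Sph d}
    (hY : ∀ t, Measurable (Y t)) (hX₀ : Measurable X₀) (hlaw : ∀ t, P.map (Y t) = unif d)
    (hYi : iIndepFun Y P) (hXY : IndepFun X₀ (fun ω t => Y t ω) P)
    (hinj : ∀ᵐ ω ∂P, Function.Injective (X₀ ω)) (γ : ℕ → ℝ) :
    ∀ᵐ ω ∂P, ∀ t, Function.Injective (sgd γ (fun s => Y s ω) (X₀ ω) t) := by
  have := isProbabilityMeasure_unif hd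
  refine ae_all_iff.2 fun t => ?_
  induction t with
  | zero => exact hinj
  | succ t ih =>
    set X : Ω → Fin n → Sph d := fun ω => sgd γ (fun s => Y s ω) (X₀ ω) t with hX
    have hXm' := measurable_sgd_pastFiltration hY hX₀ γ t
    have hXm : Measurable X := hXm'.mono ((pastFiltration hY hX₀).le t) le_rfl
    have hi : IndepFun X (Y t) P := (IndepFun_iff_Indep _ _ _).2
      (indep_of_indep_of_le_left (indep_pastFiltration hY hX₀ hYi hXY t) hXm'.comap_le)
    have hm := (indepFun_iff_map_prod_eq_prod_map_map hXm.aemeasurable (hY t).aemeasurable).1 hi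
    rw [hlaw] at hm
    have hIm : MeasurableSet {Z : Fin n → Sph d | Function.Injective Z} := by
      have he : {Z : Fin n → Sph d | Function.Injective Z} =
          ⋂ i, ⋂ j, ⋂ _ : i ≠ j, {Z | Z i = Z j}ᶜ := by
        ext Z
        simp only [Set.mem_iInter]
        exact ⟨fun h i j hij h' => hij (h h'), fun h i j h' => by
          by_contra hij
          exact h i j hij h'⟩
      rw [he]
      exact MeasurableSet.iInter fun i => MeasurableSet.iInter fun j => MeasurableSet.iInter
        fun _ => (measurableSet_eq_fun (measurable_pi_apply i) (measurable_pi_apply j)).compl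
    have hSm : Measurable fun p : (Fin n → Sph d) × Sph d => step (γ t) p.2 p.1 :=
      measurable_fst.lloydStep (γ t) measurable_snd
    -- The current configuration is independent of the next sample, so Fubini reduces the claim to a
    -- fixed injective configuration.
    have hae : ∀ᵐ p ∂((P.map X).prod (unif d)), Function.Injective (step (γ t) p.2 p.1) := by
      refine (Measure.ae_prod_iff_ae_ae (hSm hIm)).2 ?_
      filter_upwards [(ae_map_iff hXm.aemeasurable hIm).2 ih] with Z hZ
      exact ae_injective_step hd hn hZ (γ t)
    rw [← hm] at hae
    exact ae_of_ae_map (hXm.prodMk (hY t)).aemeasurable hae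

end SGD

/-! ### Descent inequality and convergence of the iteration. -/

theorem lloyd_nonneg (X : Fin n → Sph d) : 0 ≤ lloyd X :=
  integral_nonneg fun _ => Real.iInf_nonneg fun _ => by positivity

/-- Semiconcavity along `c • Q X y`, with `Q` split into its mean, which yields the decrease, and a
centered part, which is the martingale increment. -/
theorem lloyd_step_le (hd : 2 ≤ d) (hn : 1 ≤ n) {X : Fin n → Sph d} (hX : Function.Injective X)
    (c : ℝ) (y : Sph d) :
    lloyd (step c y X) ≤ lloyd X - c * ‖meanQ X‖ ^ 2 +
      (1 / 2 * (Real.pi * √(n : ℝ)) ^ 2 * c ^ 2 - c * ⟪meanQ X, Q X y - meanQ X⟫_ℝ) := by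
  have h := lloyd_le_of_eq_expVec hd hn hX (X' := step c y X) (v := c • Q X y)
    (fun i => by
      rw [PiLp.smul_apply, inner_smul_right]
      exact mul_eq_zero_of_right _ (inner_Qi X y i)) fun i => coe_step c y X i
  rw [inner_smul_right, norm_smul, mul_pow, Real.norm_eq_abs, sq_abs] at h
  rw [inner_sub_right, real_inner_self_eq_norm_sq]
  have h1 := mul_le_mul_of_nonneg_left (pow_le_pow_left₀ (norm_nonneg _) (norm_Q_le X y) 2)
    (sq_nonneg c)
  linarith

theorem norm_toAmb_step_sub_le (X : Fin n → Sph d) (c : ℝ) (y : Sph d) :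
    ‖toAmb (step c y X) - toAmb X - c • Q X y‖ ≤ 3 * Real.pi ^ 2 * √(n : ℝ) * c ^ 2 := by
  have h : ‖toAmb (step c y X) - toAmb X - c • Q X y‖ ≤ 3 * (c ^ 2 * Real.pi ^ 2) * √(n : ℝ) := by
    refine norm_le_of_forall_norm_le (by positivity) fun i => ?_
    have h1 := norm_expVec_sub_le (X i) (c • Qi X y i)
    rw [← coe_step, norm_smul, mul_pow, Real.norm_eq_abs, sq_abs] at h1
    have h2 := mul_le_mul_of_nonneg_left
      (pow_le_pow_left₀ (norm_nonneg _) (norm_Qi_le X y i) 2) (sq_nonneg c)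
    exact h1.trans (by linarith)
  linarith

theorem dist_le_dist_toAmb (X X' : Fin n → Sph d) : dist X X' ≤ dist (toAmb X) (toAmb X') := by
  refine (dist_pi_le_iff dist_nonneg).2 fun i => ?_
  rw [Subtype.dist_eq, dist_eq_norm, dist_eq_norm]
  exact PiLp.norm_apply_le (toAmb X - toAmb X') i

theorem exists_tendsto_of_forall_inner {ι E : Type*} [Fintype ι] [NormedAddCommGroup E]
    [InnerProductSpace ℝ E] (b : OrthonormalBasis ι ℝ E) {f : ℕ → E}
    (h : ∀ i, ∃ l, Tendsto (fun t => ⟪b i, f t⟫_ℝ) atTop (𝓝 l)) :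
    ∃ l, Tendsto f atTop (𝓝 l) := by
  choose l hl using h
  refine ⟨∑ i, l i • b i, ?_⟩
  have h1 : Tendsto (fun t => ∑ i, ⟪b i, f t⟫_ℝ • b i) atTop (𝓝 (∑ i, l i • b i)) :=
    tendsto_finsetSum _ fun i _ => (hl i).smul_const _
  simpa only [b.sum_repr'] using h1

section SGD

variable {Ω : Type*} {mΩ : MeasurableSpace Ω} {P : Measure Ω} [IsProbabilityMeasure P]

/-- The noise of stochastic gradient descent, tested against a bounded function of the current
configuration, has almost surely convergent partial sums. -/
theorem ae_tendsto_sum_noise (hd : 2 ≤ d) {Y : ℕ → Ω → Sph d} {X₀ : Ω → Fin n → Sph d}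
    (hY : ∀ t, Measurable (Y t)) (hX₀ : Measurable X₀) (hlaw : ∀ t, P.map (Y t) = unif d)
    (hYi : iIndepFun Y P) (hXY : IndepFun X₀ (fun ω t => Y t ω) P) {γ : ℕ → ℝ}
    (hγ : Summable fun t => γ t ^ 2) {c : (Fin n → Sph d) → Amb d n} (hc : Measurable c) {K : ℝ}
    (hK : ∀ X, ‖c X‖ ≤ K) :
    ∀ᵐ ω ∂P, ∃ l, Tendsto (fun T => ∑ t ∈ Finset.range T, γ t *
      ⟪c (sgd γ (fun s => Y s ω) (X₀ ω) t), Q (sgd γ (fun s => Y s ω) (X₀ ω) t) (Y t ω) -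
        meanQ (sgd γ (fun s => Y s ω) (X₀ ω) t)⟫_ℝ) atTop (𝓝 l) := by
  have hQ : Measurable fun p : (Fin n → Sph d) × Sph d => Q p.1 p.2 :=
    measurable_fst.lloydQ measurable_snd
  set h : (Fin n → Sph d) × Sph d → ℝ := fun p => ⟪c p.1, Q p.1 p.2 - meanQ p.1⟫_ℝ with hdef
  have hq : Measurable fun p : (Fin n → Sph d) × Sph d => meanQ p.1 := by
    have := (measurable_meanQ (n := n) hd).comp
      (measurable_fst : Measurable (Prod.fst : (Fin n → Sph d) × Sph d → _))
    rwa [Function.comp_def] at this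
  have hh : Measurable h := (hc.comp measurable_fst).inner (hQ.sub hq)
  have hC : ∀ p, |h p| ≤ K * (Real.pi * √(n : ℝ) + Real.pi * √(n : ℝ)) := fun p => by
    refine (abs_real_inner_le_norm _ _).trans ?_
    exact mul_le_mul (hK _) ((norm_sub_le _ _).trans
      (add_le_add (norm_Q_le _ _) (norm_meanQ_le hd _))) (norm_nonneg _)
      ((norm_nonneg _).trans (hK p.1))
  have h0 : ∀ X, ∫ y, h (X, y) ∂unif d = 0 := fun X => integral_inner_Q_sub_meanQ hd X (c X)
  exact ae_tendsto_sum_of_indep (h := h) (α := Fin n → Sph d) (β := Sph d)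
    (pastFiltration hY hX₀) (V := fun t ω => sgd γ (fun s => Y s ω) (X₀ ω) t) (Y := Y)
    (measurable_sgd_pastFiltration hY hX₀ γ) (measurable_sample_pastFiltration hY hX₀)
    (indep_pastFiltration hY hX₀ hYi hXY) hlaw hγ hh hC h0

/-- Almost sure convergence of Riemannian stochastic gradient descent for the Lloyd objective. -/
theorem ae_tendsto_sgd (hd : 2 ≤ d) (hn : 1 ≤ n) {Y : ℕ → Ω → Sph d} {X₀ : Ω → Fin n → Sph d}
    (hY : ∀ t, Measurable (Y t)) (hX₀ : Measurable X₀) (hlaw : ∀ t, P.map (Y t) = unif d)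
    (hYi : iIndepFun Y P) (hXY : IndepFun X₀ (fun ω t => Y t ω) P)
    (hinj : ∀ᵐ ω ∂P, Function.Injective (X₀ ω)) {γ : ℕ → ℝ} (hγ0 : ∀ t, 0 ≤ γ t)
    (hγ2 : Summable fun t => γ t ^ 2)
    (hγ : Tendsto (fun T => ∑ t ∈ Finset.range T, γ t) atTop atTop) :
    ∀ᵐ ω ∂P, (∀ t, Function.Injective (sgd γ (fun s => Y s ω) (X₀ ω) t)) ∧
      (∃ l : ℝ, Tendsto (fun t => lloyd (sgd γ (fun s => Y s ω) (X₀ ω) t)) atTop (𝓝 l)) ∧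
      Tendsto (fun t => meanQ (sgd γ (fun s => Y s ω) (X₀ ω) t)) atTop (𝓝 0) := by
  set b := stdOrthonormalBasis ℝ (Amb d n) with hb
  -- The noise is tested against fixed basis vectors to control the trajectory, and below against
  -- `meanQ` to control the objective.
  have hcoord := ae_all_iff.2 fun i => ae_tendsto_sum_noise hd hY hX₀ hlaw hYi hXY hγ2
    (c := fun _ : Fin n → Sph d => b i) measurable_const (K := 1) fun _ => (b.norm_eq_one i).le
  filter_upwards [ae_injective_sgd hd hn hY hX₀ hlaw hYi hXY hinj γ, hcoord,
    ae_tendsto_sum_noise hd hY hX₀ hlaw hYi hXY hγ2 (measurable_meanQ hd) (norm_meanQ_le hd)]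
    with ω hω hcω hdω
  set X : ℕ → Fin n → Sph d := fun t => sgd γ (fun s => Y s ω) (X₀ ω) t with hX
  have hXs : ∀ t, X (t + 1) = step (γ t) (Y t ω) (X t) := fun t => rfl
  obtain ⟨l₁, hl₁⟩ := hdω
  set K := Real.pi * √(n : ℝ) with hK
  have hm := ((hγ2.mul_left (1 / 2 * K ^ 2)).hasSum.tendsto_sum_nat).sub hl₁
  simp only [← Finset.sum_sub_distrib] at hm
  obtain ⟨hL, hsum⟩ := exists_tendsto_and_summable_of_le (a := fun t => lloyd (X t))
    (b := fun t => γ t * ‖meanQ (X t)‖ ^ 2) (fun t => lloyd_nonneg _)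
    (fun t => mul_nonneg (hγ0 t) (sq_nonneg _))
    (fun t => lloyd_step_le hd hn (hω t) (γ t) (Y t ω)) hm
  refine ⟨hω, hL, ?_⟩
  obtain ⟨l₂, hl₂⟩ : ∃ l, Tendsto (fun T => ∑ t ∈ Finset.range T,
      γ t • (Q (X t) (Y t ω) - meanQ (X t))) atTop (𝓝 l) := by
    refine exists_tendsto_of_forall_inner b fun i => ?_
    simp only [inner_sum, inner_smul_right]
    exact hcω i
  -- In the ambient space the exponential step is a linear step up to `O(γ t ^ 2)`, so curvature
  -- only adds a summable error.
  have hrem : Summable fun t => toAmb (X (t + 1)) - toAmb (X t) - γ t • Q (X t) (Y t ω) :=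
    Summable.of_norm_bounded (hγ2.mul_left (3 * Real.pi ^ 2 * √(n : ℝ)))
      fun t => norm_toAmb_step_sub_le (X t) (γ t) (Y t ω)
  have he := hrem.hasSum.tendsto_sum_nat.add hl₂
  simp only [← Finset.sum_add_distrib] at he
  have hγlim : Tendsto γ atTop (𝓝 0) := by
    have h := (hγ2.tendsto_atTop_zero).sqrt
    simpa only [Real.sqrt_sq (hγ0 _), Real.sqrt_zero] using h
  refine tendsto_zero_of_perturbed_gradient (Z := fun t => toAmb (X t)) hγ0 hγlim hγ
    (fun t => norm_meanQ_le hd (X t)) (fun t => ?_) he hsum fun ε hε => ?_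
  · simp only [smul_sub]
    abel
  · obtain ⟨δ, hδ, h⟩ := exists_norm_meanQ_lt hd hn hε
    exact ⟨δ, hδ, fun s t hs hst =>
      h _ _ (hω s) (hω t) hs ((dist_le_dist_toAmb _ _).trans hst)⟩

end SGD

end Lloyd

theorem mainTheorem6 (d n : ℕ) (hd : 2 ≤ d) (hn : 1 ≤ n) :
    -- the gradient formula, for all centers at once and blockwise
    (∀ X : Fin n → Lloyd.Sph d, Function.Injective X →
      (Integrable (Lloyd.Q X) (Lloyd.unif d) ∧
        Lloyd.HasRiemGradAt Lloyd.lloyd (-∫ y, Lloyd.Q X y ∂(Lloyd.unif d)) X ∧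
        ‖-∫ y, Lloyd.Q X y ∂(Lloyd.unif d)‖ ≤ Real.pi * √(n : ℝ)) ∧
      ∀ i : Fin n,
        Integrable (fun y => Lloyd.Qi X y i) (Lloyd.unif d) ∧
        Lloyd.HasSphGradAt (fun x => Lloyd.lloyd (Function.update X i x))
          (-∫ y, Lloyd.Qi X y i ∂(Lloyd.unif d)) (X i)) ∧
    -- the length of each block, and the bounds
    (∀ (X : Fin n → Lloyd.Sph d) (y : Lloyd.Sph d),
      (∀ i : Fin n,
        (y ≠ -X i → ‖Lloyd.Qi X y i‖ =
          Lloyd.geoDist (X i) y * (Lloyd.voronoi X i).indicator (fun _ => (1 : ℝ)) y) ∧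
        ‖Lloyd.Qi X y i‖ ≤ Real.pi) ∧
      ‖Lloyd.Q X y‖ ≤ Real.pi * √(n : ℝ)) ∧
    -- convergence of Riemannian stochastic gradient descent
    (∀ (Ω : Type*) [MeasurableSpace Ω] (P : Measure Ω) [IsProbabilityMeasure P]
      (γ : ℕ → ℝ) (Y : ℕ → Ω → Lloyd.Sph d) (X₀ : Ω → Fin n → Lloyd.Sph d),
      (∀ t, 0 ≤ γ t) →
      Summable (fun t => γ t ^ 2) →
      Tendsto (fun T => ∑ t ∈ Finset.range T, γ t) atTop atTop →
      (∀ t, Measurable (Y t)) →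
      (∀ t, P.map (Y t) = Lloyd.unif d) →
      iIndepFun Y P →
      Measurable X₀ →
      IndepFun X₀ (fun ω t => Y t ω) P →
      (∀ᵐ ω ∂P, Function.Injective (X₀ ω)) →
      ∀ᵐ ω ∂P,
        (∀ t, Function.Injective (Lloyd.sgd γ (fun s => Y s ω) (X₀ ω) t)) ∧
        (∃ l : ℝ, Tendsto (fun t => Lloyd.lloyd (Lloyd.sgd γ (fun s => Y s ω) (X₀ ω) t))
          atTop (𝓝 l)) ∧
        ∃ G : ℕ → Lloyd.Amb d n,
          (∀ t, Lloyd.HasRiemGradAt Lloyd.lloyd (G t)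
            (Lloyd.sgd γ (fun s => Y s ω) (X₀ ω) t)) ∧
          Tendsto G atTop (𝓝 0)) := by
  refine ⟨fun X hX => ⟨⟨Lloyd.integrable_Q hd X, Lloyd.hasRiemGradAt_lloyd hd hn hX, ?_⟩,
    fun i => ⟨Lloyd.integrable_Qi hd X i, ?_⟩⟩,
    fun X y => ⟨fun i => ⟨Lloyd.norm_Qi, Lloyd.norm_Qi_le X y i⟩, Lloyd.norm_Q_le X y⟩, ?_⟩
  · rw [norm_neg]
    exact Lloyd.norm_meanQ_le hd X
  · rw [← Lloyd.meanQ_apply hd]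
    exact Lloyd.hasSphGradAt_lloyd hd hn hX i
  · intro Ω _ P _ γ Y X₀ hγ0 hγ2 hγ hY hlaw hYi hX₀ hXY hinj
    filter_upwards [Lloyd.ae_tendsto_sgd hd hn hY hX₀ hlaw hYi hXY hinj hγ0 hγ2 hγ] with ω hω
    exact ⟨hω.1, hω.2.1, _, fun t => Lloyd.hasRiemGradAt_lloyd hd hn (hω.1 t), by
      simpa using hω.2.2.neg⟩
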